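/- **Setting.** $N$ plants $x^i_{k+1}=A_ix^i_k+B_iu^i_k+w^i_k$, $i=1,\dots,N$, share links $0,\dots,D$; a state sent over link $d$ at time $k$ arrives at time $k+d$. Link $d$ has price $\lambda_d$, $\lambda_0>\dots>\lambda_D\ge 0$, and capacity $c_d\in\mathbb N$, where $c_d<N$ and $\sum_d c_d\ge N$. The initial states $x_0^i$ have finite second moments, $w^i_k\sim\mathcal N(0,\Sigma^i_w)$ with $\Sigma_w^i\succ0$, and all $x^i_0,w^i_k$ are mutually independent. At each time $k$, delay controller $i$ requests one link, coded by a one-hot vector $\theta^i_k\in\{0,1\}^{D+1}$, and the resource manager grants it one link, $\vartheta^i_k$. Let $\mathcal Y^i_k$ be the collection, labelled by $d=0,\dots,D$, of what arrives at time $k$ over link $d$: the state $x^i_{k-d}$ if $k\ge d$ and $\vartheta^i_{k-d}(d)=1$, otherwise nothing. Decisions are measurable functions of the information: - plant controller, $u^i_k=\gamma^i_k(\mathcal I^i_k)$, $\mathcal I^i_k=\{\mathcal Y^i_{[0,k]},\theta^i_{[0,k]},\vartheta^i_{[0,k]},u^i_{[0,k-1]}\}$; - delay controller, $\theta^i_k=\xi^i_k(\bar{\mathcal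 I}^i_k)$, $\bar{\mathcal I}^i_k=\{\theta^i_{[0,k-1]},\vartheta^i_{[0,k-1]},u^i_{[0,k-1]}\}$, or only a fixed choice of these three groups of variables (e.g. without $\vartheta^i$); - resource manager, $\vartheta_k=\pi_k(\tilde{\mathcal I}_k)$, $\tilde{\mathcal I}_k=\{\theta_{[0,k]},\vartheta_{[0,k-1]}\}$ for all sub-systems jointly. (Assumption 1: the plant inputs and plant control laws do not enter $\pi_k$.) Let $Q_1^i,Q_2^i\succeq0$, $R^i\succ0$, $\Lambda=(\lambda_0,\dots,\lambda_D)^\top$, $\Delta=(0,1,\dots,D)^\top$, tolerances $\alpha_i,\beta_i\in\{0,\dots,D\}$, and for $\sigma\in\{\theta,\vartheta\}$ $$J^i(u^i,\sigma^i)=\mathbb E\Big[\|x^i_T\|^2_{Q^i_2}+\sum_{k=0}^{T-1}\|x^i_k\|^2_{Q^i_1}+\|u^i_k\|^2_{R^i}+\sigma_k^{i\top}\Lambda\Big]\in[0,\infty].$$ The social problem is to minimize over $(\gamma,\xi,\pi)$ jointly $$J=\frac1N\sum_{i=1}^N\Big(J^i(u^i,\vartheta^i)-\min J^i(u^i,\theta^i)\Big),$$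 where the inner minimum is over the plant and delay control laws when every request is granted ($\vartheta=\theta$), subject to $-\alpha_i\le(\vartheta^i_k-\theta^i_k)^\top\Delta\le\beta_i$ for all $i$ and $\sum_j\vartheta^j_k(d)\le c_d$ for all $d$, almost surely, for $k=0,\dots,T-1$. A law $\gamma$ is called of certainty-equivalence form (with given $\xi,\pi$) if, almost surely, for all $i$ and $k=0,\dots,T-1$, $$u^i_k=-L^i_k\,\mathbb E[x^i_k\mid\mathcal I^i_k],\qquad L^i_k=(R^i+B_i^\top P^i_{k+1}B_i)^{-1}B_i^\top P^i_{k+1}A_i,$$ where $P^i_T=Q^i_2$ and $P^i_k=Q^i_1+A_i^\top\big[P^i_{k+1}-P^i_{k+1}B_i(R^i+B_i^\top P^i_{k+1}B_i)^{-1}B_i^\top P^i_{k+1}\big]A_i$. **Theorem 1.** The inner minima are finite and attained, and the social problem has an optimal triple. In every optimal triple $(\gamma,\xi,\pi)$ the plant control law is of certainty-equivalence form. Moreover, the control design separates from the delay-control and resource-allocation decisions, in the following sense. 1. For all $\xi,\pi$ there is a law $\gamma$ of certainty-equivalence form. 2. A triple is optimal if and only if it is feasible, $\gamma$ is of certainty-equivalence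 form, and it minimizes $J$ among the feasible triples whose $\gamma$ is of that form. 3. If two triples generate almost surely the same grants $\vartheta_k$, $k<T$, and the first has a law of certainty-equivalence form, then its social cost is at most that of the second, with equality only if the second law is of that form too. 4. If the laws $\xi^i$ do not use the inputs $u^i$, then, for fixed $\xi,\pi$, a law $\gamma$ minimizes $J$ over all plant control laws if and only if it is of certainty-equivalence form. -/

import Mathlib

open MeasureTheory ProbabilityTheory
open scoped Matrix ENNReal

noncomputable section

/-- Constant data of `N` linear plants that share a network with links of latency `0, …, D`,
over the horizon `0, …, T`. -/
structure NCS where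
  /-- number of sub-systems -/
  N : ℕ
  /-- largest link latency -/
  D : ℕ
  /-- horizon -/
  T : ℕ
  /-- state dimensions -/
  n : Fin N → ℕ
  /-- input dimensions -/
  m : Fin N → ℕ
  A : ∀ i, Matrix (Fin (n i)) (Fin (n i)) ℝ
  B : ∀ i, Matrix (Fin (n i)) (Fin (m i)) ℝ
  Q₁ : ∀ i, Matrix (Fin (n i)) (Fin (n i)) ℝ
  Q₂ : ∀ i, Matrix (Fin (n i)) (Fin (n i)) ℝ
  R : ∀ i, Matrix (Fin (m i)) (Fin (m i)) ℝ
  /-- covariance of the process noise -/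
  noiseCov : ∀ i, Matrix (Fin (n i)) (Fin (n i)) ℝ
  /-- price of each link -/
  price : Fin (D + 1) → ℝ
  /-- capacity of each link -/
  cap : Fin (D + 1) → ℕ
  /-- tolerated reduction of the requested latency -/
  α : Fin N → Fin (D + 1)
  /-- tolerated increase of the requested latency -/
  β : Fin N → Fin (D + 1)
  Q₁_posSemidef : ∀ i, (Q₁ i).PosSemidef
  Q₂_posSemidef : ∀ i, (Q₂ i).PosSemidef
  R_posDef : ∀ i, (R i).PosDef
  noiseCov_posDef : ∀ i, (noiseCov i).PosDef
  price_strictAnti : StrictAnti price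
  price_nonneg : ∀ d, 0 ≤ price d
  cap_lt : ∀ d, cap d < N
  le_sum_cap : N ≤ ∑ d, cap d

namespace NCS

/-- Links, named by their latency. -/
abbrev Link (S : NCS) : Type := Fin (S.D + 1)

abbrev State (S : NCS) (i : Fin S.N) : Type := Fin (S.n i) → ℝ

abbrev Input (S : NCS) (i : Fin S.N) : Type := Fin (S.m i) → ℝ

/-- The binary decision vector, with exactly one entry `1`, that selects link `d`. -/
def selection (S : NCS) (d : S.Link) : S.Link → ℝ := Pi.single d 1

/-- The vector `(0, 1, …, D)`. -/
def latency (S : NCS) : S.Link → ℝ := fun d => (d : ℕ)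

/-- What a link hands over at one instant: a state, or nothing. -/
abbrev Packet (S : NCS) (i : Fin S.N) : Type := S.State i ⊕ Unit

/-- Values of the plant controller's information at time `k`: the packets received at times
`0, …, k` over each link, the requests and the grants at times `0, …, k`, and the inputs at times
`0, …, k - 1`. -/
abbrev PlantInfo (S : NCS) (i : Fin S.N) (k : ℕ) : Type :=
  (Fin (k + 1) → S.Link → S.Packet i) × (Fin (k + 1) → S.Link) × (Fin (k + 1) → S.Link) ×
    (Fin k → S.Input i)

/-- Values of the delay controller's largest information at time `k`: its own requests, grants and
inputs at times `0, …, k - 1`. -/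
abbrev DelayInfo (S : NCS) (i : Fin S.N) (k : ℕ) : Type :=
  (Fin k → S.Link) × (Fin k → S.Link) × (Fin k → S.Input i)

/-- Values of the resource manager's information at time `k`: the requests of all sub-systems at
times `0, …, k` and the grants at times `0, …, k - 1`. No plant input enters. -/
abbrev ManagerInfo (S : NCS) (k : ℕ) : Type :=
  (Fin (k + 1) → Fin S.N → S.Link) × (Fin k → Fin S.N → S.Link)

/-- Measurable plant control laws `γ`, delay control laws `ξ` and resource allocation laws `π`. -/
structure Policies (S : NCS) where
  γ : ∀ i k, S.PlantInfo i k → S.Input i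
  ξ : ∀ i k, S.DelayInfo i k → S.Link
  π : ∀ k, S.ManagerInfo k → Fin S.N → S.Link
  measurable_γ : ∀ i k, Measurable (γ i k)
  measurable_ξ : ∀ i k, Measurable (ξ i k)
  measurable_π : ∀ k, Measurable (π k)

/-- The kinds of past variables that a delay controller may observe. -/
inductive Signal
  | request
  | grant
  | control

/-- The delay control laws `ξ` use only the kinds of variables in `V`. All three kinds give the
reactive delay controllers, `{request, control}` the impassive ones. -/
def UsesOnly (S : NCS) (V : Set Signal) (ξ : ∀ i k, S.DelayInfo i k → S.Link) : Prop :=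
  ∀ i k (I J : S.DelayInfo i k),
    (Signal.request ∈ V → I.1 = J.1) → (Signal.grant ∈ V → I.2.1 = J.2.1) →
    (Signal.control ∈ V → I.2.2 = J.2.2) → ξ i k I = ξ i k J

/-- The quadratic form of the matrix `Q`. -/
def quad {l : ℕ} (Q : Matrix (Fin l) (Fin l) ℝ) (v : Fin l → ℝ) : ℝ := v ⬝ᵥ Q *ᵥ v

/-- The Riccati matrix with `j` steps to go. -/
def riccatiToGo (S : NCS) (i : Fin S.N) : ℕ → Matrix (Fin (S.n i)) (Fin (S.n i)) ℝ
  | 0 => S.Q₂ i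
  | j + 1 =>
    let P := riccatiToGo S i j
    S.Q₁ i + (S.A i)ᵀ *
      (P - P * S.B i * (S.R i + (S.B i)ᵀ * P * S.B i)⁻¹ * (S.B i)ᵀ * P) * S.A i

/-- The Riccati matrix at time `k ≤ T`, with value `Q₂` at time `T`. -/
def riccati (S : NCS) (i : Fin S.N) (k : ℕ) : Matrix (Fin (S.n i)) (Fin (S.n i)) ℝ :=
  S.riccatiToGo i (S.T - k)

/-- The LQR gain at time `k < T`. -/
def gain (S : NCS) (i : Fin S.N) (k : ℕ) : Matrix (Fin (S.m i)) (Fin (S.n i)) ℝ :=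
  (S.R i + (S.B i)ᵀ * S.riccati i (k + 1) * S.B i)⁻¹ * (S.B i)ᵀ * S.riccati i (k + 1) * S.A i

/-- Initial states with finite second moments and Gaussian noises, all mutually independent. -/
structure Noise (S : NCS) {Ω : Type*} [MeasurableSpace Ω] (μ : Measure Ω) where
  x₀ : ∀ i, Ω → S.State i
  w : ∀ i, ℕ → Ω → S.State i
  measurable_x₀ : ∀ i, Measurable (x₀ i)
  measurable_w : ∀ i k, Measurable (w i k)
  memLp_x₀ : ∀ i, MemLp (x₀ i) 2 μ
  law_w : ∀ i k, HasLaw (fun ω => WithLp.toLp 2 (w i k ω))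
    (multivariateGaussian 0 (S.noiseCov i)) μ
  indep : iIndepFun (β := fun q : Fin S.N × Option ℕ => S.State q.1)
    (fun q => q.2.elim (x₀ q.1) (w q.1)) μ

/-- What reaches the plant controller `i` over link `d` at time `t`, for the states `x` and the
grants `g`: the state of time `t - d` if it was granted link `d`, otherwise nothing. -/
def packet (S : NCS) (i : Fin S.N) (x : ℕ → S.State i) (g : ℕ → S.Link) (t : ℕ) (d : S.Link) :
    S.Packet i :=
  if (d : ℕ) ≤ t ∧ g (t - d) = d then Sum.inl (x (t - d)) else Sum.inr ()

/-- A triple of policies with the processes that it generates: states `x`, requests `θ`, grants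
`ϑ` and inputs `u`. -/
structure ClosedLoop (S : NCS) {Ω : Type*} [MeasurableSpace Ω] {μ : Measure Ω}
    (Z : S.Noise μ) extends Policies S where
  x : ∀ i, ℕ → Ω → S.State i
  θ : ∀ _i : Fin S.N, ℕ → Ω → S.Link
  ϑ : ∀ _i : Fin S.N, ℕ → Ω → S.Link
  u : ∀ i, ℕ → Ω → S.Input i
  x_zero : ∀ i ω, x i 0 ω = Z.x₀ i ω
  x_succ : ∀ i k ω, x i (k + 1) ω = S.A i *ᵥ x i k ω + S.B i *ᵥ u i k ω + Z.w i k ω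
  θ_eq : ∀ i k ω, θ i k ω =
    ξ i k (fun t => θ i t ω, fun t => ϑ i t ω, fun t => u i t ω)
  ϑ_eq : ∀ k ω, (fun i => ϑ i k ω) =
    π k (fun t i => θ i t ω, fun t i => ϑ i t ω)
  u_eq : ∀ i k ω, u i k ω =
    γ i k (fun t d => S.packet i (fun s => x i s ω) (fun s => ϑ i s ω) t d,
      fun t => θ i t ω, fun t => ϑ i t ω, fun t => u i t ω)

section Problem

variable {S : NCS} {Ω : Type*} [MeasurableSpace Ω] {μ : Measure Ω} {Z : S.Noise μ}

/-- The information of plant controller `i` at time `k`, as a random variable. -/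
def ClosedLoop.plantInfo (e : S.ClosedLoop Z) (i : Fin S.N) (k : ℕ) (ω : Ω) : S.PlantInfo i k :=
  (fun t d => S.packet i (fun s => e.x i s ω) (fun s => e.ϑ i s ω) t d,
    fun t => e.θ i t ω, fun t => e.ϑ i t ω, fun t => e.u i t ω)

/-- The σ-algebra generated by the information of plant controller `i` at time `k`. -/
abbrev ClosedLoop.plantSigma (e : S.ClosedLoop Z) (i : Fin S.N) (k : ℕ) : MeasurableSpace Ω :=
  MeasurableSpace.comap (e.plantInfo i k) inferInstance

/-- Certainty equivalence: the input is the LQR gain applied to the conditional mean. -/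
def ClosedLoop.CertaintyEquivalent (e : S.ClosedLoop Z) : Prop :=
  ∀ i, ∀ k < S.T, e.u i k =ᵐ[μ] fun ω => -(S.gain i k *ᵥ (μ[e.x i k | e.plantSigma i k]) ω)

/-- The LQG cost of sub-system `i` plus the price of the links `σ`. The integrand is nonnegative;
the value is `∞` if it is not integrable. -/
def ClosedLoop.loopCost (e : S.ClosedLoop Z) (i : Fin S.N) (σ : ℕ → Ω → S.Link) : ℝ≥0∞ :=
  ∫⁻ ω, ENNReal.ofReal (quad (S.Q₂ i) (e.x i S.T ω) +
    ∑ k ∈ Finset.range S.T, (quad (S.Q₁ i) (e.x i k ω) + quad (S.R i) (e.u i k ω) +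
      S.selection (σ k ω) ⬝ᵥ S.price)) ∂μ

/-- Every request is granted. -/
def ClosedLoop.GrantsAll (e : S.ClosedLoop Z) : Prop :=
  ∀ i k ω, e.ϑ i k ω = e.θ i k ω

/-- The least local cost of sub-system `i` when every request is granted. (The sub-systems are
then decoupled, so that only the laws of sub-system `i` matter.) -/
def localMin (Z : S.Noise μ) (V : Set Signal) (i : Fin S.N) : ℝ≥0∞ :=
  ⨅ e : {e : S.ClosedLoop Z // S.UsesOnly V e.ξ ∧ e.GrantsAll}, e.1.loopCost i (e.1.θ i)

/-- The social cost. -/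
def ClosedLoop.socialCost (e : S.ClosedLoop Z) (V : Set Signal) : EReal :=
  (((S.N : ℝ)⁻¹ : ℝ) : EReal) *
    ∑ i, ((e.loopCost i (e.ϑ i) : EReal) - (localMin Z V i : EReal))

/-- The constraints of the social problem: the observations of the delay controllers, the latency
tolerances and the link capacities. -/
def ClosedLoop.Feasible (e : S.ClosedLoop Z) (V : Set Signal) : Prop :=
  S.UsesOnly V e.ξ ∧ ∀ᵐ ω ∂μ, ∀ k < S.T,
    (∀ i, -((S.α i : ℕ) : ℝ) ≤
        (S.selection (e.ϑ i k ω) - S.selection (e.θ i k ω)) ⬝ᵥ S.latency ∧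
      (S.selection (e.ϑ i k ω) - S.selection (e.θ i k ω)) ⬝ᵥ S.latency ≤ ((S.β i : ℕ) : ℝ)) ∧
    ∀ d, ∑ j, S.selection (e.ϑ j k ω) d ≤ (S.cap d : ℝ)

/-- The policies jointly minimize the social cost under the constraints. -/
def ClosedLoop.IsOptimal (e : S.ClosedLoop Z) (V : Set Signal) : Prop :=
  e.Feasible V ∧ ∀ f : S.ClosedLoop Z, f.Feasible V → e.socialCost V ≤ f.socialCost V

end Problem

end NCS

end

noncomputable section

namespace NCS

/-! Completing the square with the Riccati matrices turns the cost of a plant into terms in the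
initial state and the noises, link prices, and at each time a weighted square of `u + L x`. Split
the state as `est + estErr`, where the estimate is rebuilt from the received states and the known
inputs. The inputs cancel in the error. For fixed grants the error is a linear function of the
noises that entered since the latest received state, and of the centred initial state as well if
nothing was received.

The difficulty is that grants are random and may depend on inputs, hence on noise, so that they
might carry information about the error. They do not. States leave a plant only in packets, so the
noise in the error has not yet influenced any request, grant or input: on each event of given
grants, the plant information is a function of the other primitive variables. Up to a given time
there are finitely many grant sequences, and conditioning splits over these events (`indepFun_err`,
`setIntegral_comp_estErr`). Hence the estimate is the conditional mean (`condExp_x`), and the mean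
cost of the error is the average of a deterministic function of the grant sequence.

The outcome is `loopCost_eq`: if the inputs are square integrable, the local cost is the mean of
`netCost` over the realized grants plus the mean squares of `deviation` with positive definite
weights. Otherwise it is infinite, because `R` is positive definite. So a plant law acts on the cost
only through the grants and through a penalty that vanishes exactly under certainty equivalence,
which gives uniqueness and the separation statements.

For existence, `netCost` depends on finitely many grants. A best deterministic grant sequence does
at least as well as any random one, and it is realized by requesting it in open loop, which meets
the tolerances and every restriction on the observations. -/

/-- Values of all initial states and noises. -/
abbrev Seed (S : NCS) : Type := ∀ q : Fin S.N × Option ℕ, S.State q.1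

/-- Values of all states, requests, grants and inputs. -/
abbrev Path (S : NCS) : Type :=
  (∀ i, ℕ → S.State i) × (Fin S.N → ℕ → S.Link) × (Fin S.N → ℕ → S.Link) × (∀ i, ℕ → S.Input i)

/-! ### The closed-loop equations as a causal fixed-point problem. -/

section Step

variable {S : NCS}

/-- The states that follow from the states and inputs of the path `a`. -/
def nextState (n : S.Seed) (a : S.Path) (i : Fin S.N) : ℕ → S.State i
  | 0 => n (i, none)
  | k + 1 => S.A i *ᵥ a.1 i k + S.B i *ᵥ a.2.2.2 i k + n (i, some k)

/-- The requests that follow from the history of the path `a`. -/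
def nextRequest (p : S.Policies) (a : S.Path) (i : Fin S.N) (k : ℕ) : S.Link :=
  p.ξ i k (fun t => a.2.1 i t, fun t => a.2.2.1 i t, fun t => a.2.2.2 i t)

/-- The grants that follow from the history of the path `a`. -/
def nextGrant (p : S.Policies) (a : S.Path) (i : Fin S.N) (k : ℕ) : S.Link :=
  p.π k (fun t j => nextRequest p a j t, fun t j => a.2.2.1 j t) i

/-- The inputs that follow from the history of the path `a`. -/
def nextInput (p : S.Policies) (n : S.Seed) (a : S.Path) (i : Fin S.N) (k : ℕ) : S.Input i :=
  p.γ i k (fun t d => S.packet i (nextState n a i) (nextGrant p a i) t d,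
    fun t => nextRequest p a i t, fun t => nextGrant p a i t, fun t => a.2.2.2 i t)

/-- One pass through the closed-loop equations. -/
def step (p : S.Policies) (n : S.Seed) (a : S.Path) : S.Path :=
  (nextState n a, nextRequest p a, nextGrant p a, nextInput p n a)

/-- The network variables and inputs of two paths agree before time `k`. -/
def Path.AgreeBefore (a b : S.Path) (k : ℕ) : Prop :=
  ∀ t < k, ∀ j, a.2.1 j t = b.2.1 j t ∧ a.2.2.1 j t = b.2.2.1 j t ∧ a.2.2.2 j t = b.2.2.2 j t

theorem packet_congr {i : Fin S.N} {x y : ℕ → S.State i} {g h : ℕ → S.Link} {t : ℕ}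
    (hg : ∀ s ≤ t, g s = h s) (hx : ∀ s ≤ t, s + (g s : ℕ) ≤ t → x s = y s) (d : S.Link) :
    S.packet i x g t d = S.packet i y h t d := by
  unfold packet
  rw [← hg (t - d) (Nat.sub_le _ _)]
  split_ifs with hd
  · rw [hx (t - d) (Nat.sub_le _ _) (by rw [hd.2]; omega)]
  · rfl

theorem nextRequest_congr {p : S.Policies} {a b : S.Path} {k : ℕ} (h : a.AgreeBefore b k)
    {t : ℕ} (ht : t ≤ k) (j : Fin S.N) : nextRequest p a j t = nextRequest p b j t := by
  unfold nextRequest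
  congr 1
  refine Prod.ext (funext fun s => ?_) (Prod.ext (funext fun s => ?_) (funext fun s => ?_))
  · exact (h s (by omega) j).1
  · exact (h s (by omega) j).2.1
  · exact (h s (by omega) j).2.2

theorem nextGrant_congr {p : S.Policies} {a b : S.Path} {k : ℕ} (h : a.AgreeBefore b k)
    {t : ℕ} (ht : t ≤ k) (j : Fin S.N) : nextGrant p a j t = nextGrant p b j t := by
  refine congrArg (fun I => p.π t I j)
    (Prod.ext (funext fun s => funext fun l => ?_) (funext fun s => funext fun l => ?_))
  · exact nextRequest_congr h (by omega) l
  · exact (h s (by omega) l).2.1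

theorem nextInput_congr {p : S.Policies} {n n' : S.Seed} {a b : S.Path} {k : ℕ}
    (h : a.AgreeBefore b k) (j : Fin S.N)
    (hx : ∀ s ≤ k, s + (nextGrant p a j s : ℕ) ≤ k → nextState n a j s = nextState n' b j s) :
    nextInput p n a j k = nextInput p n' b j k := by
  unfold nextInput
  congr 1
  refine Prod.ext (funext fun s => funext fun l => ?_)
    (Prod.ext (funext fun s => ?_) (Prod.ext (funext fun s => ?_) (funext fun s => ?_)))
  · refine packet_congr (g := nextGrant p a j) (h := nextGrant p b j)
      (fun r hr => nextGrant_congr h (by omega) j) (fun r hr hr' => ?_) l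
    exact hx r (by omega) (by omega)
  · exact nextRequest_congr h (by omega) j
  · exact nextGrant_congr h (by omega) j
  · exact (h s s.2 j).2.2

theorem step_agree {p : S.Policies} {n : S.Seed} {a b : S.Path} {k : ℕ}
    (h : a.AgreeBefore b k) (hx : ∀ t < k, ∀ j, a.1 j t = b.1 j t) :
    (step p n a).AgreeBefore (step p n b) (k + 1) ∧
      ∀ t < k + 1, ∀ j, (step p n a).1 j t = (step p n b).1 j t := by
  have key : ∀ t < k + 1, ∀ j, nextState n a j t = nextState n b j t := by
    intro t ht j
    cases t with
    | zero => rfl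
    | succ t => simp only [nextState]; rw [hx t (by omega) j, (h t (by omega) j).2.2]
  refine ⟨fun t ht j => ⟨nextRequest_congr h (by omega) j, nextGrant_congr h (by omega) j, ?_⟩, key⟩
  exact nextInput_congr (fun s hs => h s (by omega)) j fun s hs _ => key s (by omega) j

/-- By causality each pass fixes one more time instant, whatever the starting path. This yields both
existence and uniqueness of the generated path. -/
theorem iterate_step_agree (p : S.Policies) (n : S.Seed) (a b : S.Path) (k : ℕ) :
    ((step p n)^[k] a).AgreeBefore ((step p n)^[k] b) k ∧
      ∀ t < k, ∀ j, ((step p n)^[k] a).1 j t = ((step p n)^[k] b).1 j t := by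
  induction k with
  | zero => exact ⟨fun t ht => absurd ht (Nat.not_lt_zero t), fun t ht => absurd ht (Nat.not_lt_zero t)⟩
  | succ k ih =>
    simp only [Function.iterate_succ_apply']
    exact step_agree ih.1 ih.2

/-- The path generated by the policies `p` from the seed `n`. -/
def path (p : S.Policies) (n : S.Seed) : S.Path :=
  (fun i k => ((step p n)^[k + 1] 0).1 i k, fun i k => ((step p n)^[k + 1] 0).2.1 i k,
    fun i k => ((step p n)^[k + 1] 0).2.2.1 i k, fun i k => ((step p n)^[k + 1] 0).2.2.2 i k)

theorem iterate_step_path_agree (p : S.Policies) (n : S.Seed) {t j : ℕ} (h : t < j) (i : Fin S.N) :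
    ((step p n)^[j] 0).1 i t = (path p n).1 i t ∧
    ((step p n)^[j] 0).2.1 i t = (path p n).2.1 i t ∧
    ((step p n)^[j] 0).2.2.1 i t = (path p n).2.2.1 i t ∧
    ((step p n)^[j] 0).2.2.2 i t = (path p n).2.2.2 i t := by
  obtain ⟨l, rfl⟩ := Nat.exists_eq_add_of_lt h
  have := iterate_step_agree p n ((step p n)^[l] 0) 0 (t + 1)
  rw [← Function.iterate_add_apply, show t + 1 + l = t + l + 1 by ring] at this
  have h1 := this.1 t (by omega) i
  exact ⟨this.2 t (by omega) i, h1.1, h1.2.1, h1.2.2⟩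

theorem step_path (p : S.Policies) (n : S.Seed) : step p n (path p n) = path p n := by
  have h (k : ℕ) := step_agree (p := p) (n := n) (k := k) (a := (step p n)^[k] 0)
    (b := path p n) (fun t ht j => (iterate_step_path_agree p n ht j).2)
    (fun t ht j => (iterate_step_path_agree p n ht j).1)
  simp only [← Function.iterate_succ_apply' (step p n)] at h
  refine Prod.ext ?_ (Prod.ext ?_ (Prod.ext ?_ ?_)) <;> funext i k
  · exact ((h k).2 k (by omega) i).symm
  · exact ((h k).1 k (by omega) i).1.symm
  · exact ((h k).1 k (by omega) i).2.1.symm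
  · exact ((h k).1 k (by omega) i).2.2.symm

/-- A fixed point equals all its iterates, and these agree with the iterates of the zero path on an
initial segment of any length. -/
theorem eq_path {p : S.Policies} {n : S.Seed} {a : S.Path} (ha : step p n a = a) :
    a = path p n := by
  have hi (k : ℕ) : (step p n)^[k] a = a := Function.iterate_fixed ha k
  have h (k : ℕ) := iterate_step_agree p n a 0 (k + 1)
  simp only [hi] at h
  refine Prod.ext ?_ (Prod.ext ?_ (Prod.ext ?_ ?_)) <;> funext i k
  · exact (h k).2 k (by omega) i
  · exact ((h k).1 k (by omega) i).1
  · exact ((h k).1 k (by omega) i).2.1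
  · exact ((h k).1 k (by omega) i).2.2

theorem measurable_packet {α : Type*} [MeasurableSpace α] {i : Fin S.N} {x : α → ℕ → S.State i}
    {g : α → ℕ → S.Link} (hx : ∀ s, Measurable fun a => x a s)
    (hg : ∀ s, Measurable fun a => g a s) (t : ℕ) (d : S.Link) :
    Measurable fun a => S.packet i (x a) (g a) t d := by
  unfold packet
  refine Measurable.ite ?_ (measurable_inl.comp (hx _)) measurable_const
  by_cases hd : (d : ℕ) ≤ t
  · simp only [hd, true_and]
    exact hg (t - d) (measurableSet_singleton d)
  · simp [hd]

theorem measurable_step (p : S.Policies) :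
    Measurable fun z : S.Seed × S.Path => step p z.1 z.2 := by
  have hθ (i : Fin S.N) (k : ℕ) : Measurable fun z : S.Seed × S.Path => nextRequest p z.2 i k :=
    (p.measurable_ξ i k).comp (by fun_prop)
  have hϑ (i : Fin S.N) (k : ℕ) : Measurable fun z : S.Seed × S.Path => nextGrant p z.2 i k := by
    refine (measurable_pi_apply i).comp ((p.measurable_π k).comp ?_)
    refine Measurable.prodMk ?_ (by fun_prop)
    exact measurable_pi_lambda _ fun t => measurable_pi_lambda _ fun j => hθ j t
  have hx (i : Fin S.N) (k : ℕ) :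
      Measurable fun z : S.Seed × S.Path => nextState z.1 z.2 i k := by
    cases k with
    | zero => simp only [nextState]; fun_prop
    | succ k =>
      simp only [nextState]
      have h1 : Measurable fun v : S.State i => S.A i *ᵥ v :=
        (Continuous.matrix_mulVec continuous_const continuous_id).measurable
      have h2 : Measurable fun v : S.Input i => S.B i *ᵥ v :=
        (Continuous.matrix_mulVec continuous_const continuous_id).measurable
      exact ((h1.comp (by fun_prop)).add (h2.comp (by fun_prop))).add (by fun_prop)
  have hu (i : Fin S.N) (k : ℕ) :
      Measurable fun z : S.Seed × S.Path => nextInput p z.1 z.2 i k := by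
    refine (p.measurable_γ i k).comp ?_
    refine Measurable.prodMk ?_ (Measurable.prodMk ?_ (Measurable.prodMk ?_ (by fun_prop)))
    · exact measurable_pi_lambda _ fun t => measurable_pi_lambda _ fun d =>
        measurable_packet (hx i) (hϑ i) t d
    · exact measurable_pi_lambda _ fun t => hθ i t
    · exact measurable_pi_lambda _ fun t => hϑ i t
  refine Measurable.prodMk ?_ (Measurable.prodMk ?_ (Measurable.prodMk ?_ ?_)) <;>
    refine measurable_pi_lambda _ fun i => measurable_pi_lambda _ fun k => ?_
  exacts [hx i k, hθ i k, hϑ i k, hu i k]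

theorem measurable_path (p : S.Policies) : Measurable (path p) := by
  have h (k : ℕ) : Measurable fun n => (step p n)^[k] 0 := by
    induction k with
    | zero => exact measurable_const
    | succ k ih =>
      simp only [Function.iterate_succ_apply']
      exact (measurable_step p).comp (measurable_id.prodMk ih)
  refine Measurable.prodMk ?_ (Measurable.prodMk ?_ (Measurable.prodMk ?_ ?_)) <;>
    refine measurable_pi_lambda _ fun i => measurable_pi_lambda _ fun k => ?_
  all_goals have := h (k + 1); fun_prop

/-- Initial states and noises of plant `i` that do not affect its states before time `c`. -/
def lateSeed (i : Fin S.N) (c : ℕ) : Set (Fin S.N × Option ℕ) :=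
  {q | q.1 = i ∧ c ≤ q.2.elim 0 (· + 1)}

/-- If, up to time `K`, plant controller `i` only receives states from before time `c`, then the
noises that affect only later states of plant `i` do not affect the decisions before time `K`. -/
theorem agree_of_eqOn_compl_lateSeed {p : S.Policies} {n n' : S.Seed} {a b : S.Path}
    (ha : step p n a = a) (hb : step p n' b = b) (i : Fin S.N) (c K : ℕ)
    (hn : ∀ q ∉ lateSeed i c, n q = n' q) (hc : ∀ s, s + (a.2.2.1 i s : ℕ) < K → s < c) :
    ∀ t ≤ K, a.AgreeBefore b t ∧ ∀ s ≤ t, ∀ j, (j = i → s < c) → a.1 j s = b.1 j s := by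
  have hx (z : S.Seed) (y : S.Path) (hy : step p z y = y) : nextState z y = y.1 :=
    congrArg Prod.fst hy
  have hθ (z : S.Seed) (y : S.Path) (hy : step p z y = y) : nextRequest p y = y.2.1 :=
    congrArg (fun r => r.2.1) hy
  have hϑ (z : S.Seed) (y : S.Path) (hy : step p z y = y) : nextGrant p y = y.2.2.1 :=
    congrArg (fun r => r.2.2.1) hy
  have hu (z : S.Seed) (y : S.Path) (hy : step p z y = y) : nextInput p z y = y.2.2.2 :=
    congrArg (fun r => r.2.2.2) hy
  intro t
  induction t with
  | zero =>
    refine fun _ => ⟨fun t ht => absurd ht (Nat.not_lt_zero t), fun s hs j hj => ?_⟩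
    obtain rfl : s = 0 := by omega
    rw [← hx n a ha, ← hx n' b hb]
    refine hn _ fun h => ?_
    have h1 := hj h.1
    have h2 := h.2
    simp at h2
    omega
  | succ t ih =>
    intro ht
    obtain ⟨ih1, ih2⟩ := ih (by omega)
    have h1 : a.AgreeBefore b (t + 1) := by
      intro s hs j
      rcases Nat.lt_succ_iff_lt_or_eq.1 hs with hs | rfl
      · exact ih1 s hs j
      refine ⟨?_, ?_, ?_⟩
      · rw [← hθ n a ha, ← hθ n' b hb]; exact nextRequest_congr ih1 le_rfl j
      · rw [← hϑ n a ha, ← hϑ n' b hb]; exact nextGrant_congr ih1 le_rfl j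
      · rw [← hu n a ha, ← hu n' b hb]
        -- The input depends on the states only through packets that have arrived. For plant `i`
        -- these carry states from before time `c`, by `hc`.
        refine nextInput_congr ih1 j fun r hr hr' => ?_
        rw [hx n a ha, hx n' b hb]
        refine ih2 r hr j fun hj => hc r ?_
        rw [hϑ n a ha, hj] at hr'
        omega
    refine ⟨h1, fun s hs j hj => ?_⟩
    rcases Nat.lt_succ_iff_lt_or_eq.1 (Nat.lt_succ_of_le hs) with hs | rfl
    · exact ih2 s (by omega) j hj
    rw [← hx n a ha, ← hx n' b hb]
    simp only [nextState]
    -- For `j = i`, the noise of time `t` enters the state of time `t + 1 < c`, so it is not late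
    -- and the seeds agree there.
    rw [ih2 t le_rfl j (fun h => by have := hj h; omega), (h1 t (by omega) j).2.2,
      hn (j, some t) fun h => ?_]
    have h1 := hj h.1
    have h2 := h.2
    simp at h2
    omega

end Step

/-! ### Pathwise estimate and error of a plant controller. -/

section Estimation

variable {S : NCS}

/-- The information of plant controller `i` at time `k` along the path `a`. -/
def Path.plantInfo (a : S.Path) (i : Fin S.N) (k : ℕ) : S.PlantInfo i k :=
  (fun t d => S.packet i (a.1 i) (a.2.2.1 i) t d, fun t => a.2.1 i t, fun t => a.2.2.1 i t,
    fun t => a.2.2.2 i t)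

/-- The error at time `s` of the estimate that is built from the states received by time `k`
under the grants `g`. -/
def err (i : Fin S.N) (m₀ : S.State i) (k : ℕ) (g : ℕ → S.Link) (n : S.Seed) : ℕ → S.State i
  | 0 => if 0 + (g 0 : ℕ) ≤ k then 0 else n (i, none) - m₀
  | s + 1 => if s + 1 + (g (s + 1) : ℕ) ≤ k then 0
      else S.A i *ᵥ err i m₀ k g n s + n (i, some s)

/-- The state of time `s` as found among the packets in `I`. -/
def PlantInfo.received {i : Fin S.N} {k : ℕ} (I : S.PlantInfo i k) (s : ℕ) : S.State i :=
  (I.1 (Fin.ofNat (k + 1) (s + (I.2.2.1 (Fin.ofNat (k + 1) s) : ℕ)))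
    (I.2.2.1 (Fin.ofNat (k + 1) s))).elim id 0

/-- The estimate of the state of time `s`: the state itself if it was received, otherwise the
prediction from the estimate one step before. -/
def estimate (i : Fin S.N) (m₀ : S.State i) {k : ℕ} (I : S.PlantInfo i k) : ℕ → S.State i
  | 0 => if 0 + (I.2.2.1 (Fin.ofNat (k + 1) 0) : ℕ) ≤ k then PlantInfo.received I 0 else m₀
  | s + 1 =>
    if s + 1 + (I.2.2.1 (Fin.ofNat (k + 1) (s + 1)) : ℕ) ≤ k then PlantInfo.received I (s + 1)
    else S.A i *ᵥ estimate i m₀ I s + S.B i *ᵥ (if h : s < k then I.2.2.2 ⟨s, h⟩ else 0)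

theorem PlantInfo.received_plantInfo (a : S.Path) (i : Fin S.N) {k s : ℕ}
    (h : s + (a.2.2.1 i s : ℕ) ≤ k) : PlantInfo.received (a.plantInfo i k) s = a.1 i s := by
  -- `Fin.ofNat` reduces modulo `k + 1`; for a state that has arrived, both the sending and the
  -- arrival time are at most `k`, so nothing wraps.
  have h1 : s % (k + 1) = s := Nat.mod_eq_of_lt (by omega)
  have h2 : (s + (a.2.2.1 i s : ℕ)) % (k + 1) = s + (a.2.2.1 i s : ℕ) :=
    Nat.mod_eq_of_lt (by omega)
  simp [PlantInfo.received, Path.plantInfo, h1, h2, packet]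

/-- A received state resets the error to zero. Between resets the known input drives the estimate
exactly as it drives the state, so the error evolves by the plant matrix and the noise alone. -/
theorem estimate_add_err {p : S.Policies} {n : S.Seed} {a : S.Path} (ha : step p n a = a)
    (i : Fin S.N) (m₀ : S.State i) (k : ℕ) :
    ∀ s ≤ k, estimate i m₀ (a.plantInfo i k) s + err i m₀ k (a.2.2.1 i) n s = a.1 i s := by
  have hx : nextState n a = a.1 := congrArg Prod.fst ha
  intro s
  induction s with
  | zero =>
    intro _
    have h0 : (a.plantInfo i k).2.2.1 (Fin.ofNat (k + 1) 0) = a.2.2.1 i 0 := by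
      simp [Path.plantInfo]
    by_cases h : 0 + (a.2.2.1 i 0 : ℕ) ≤ k
    · simp only [estimate, err, h0, if_pos h, PlantInfo.received_plantInfo a i h, add_zero]
    · simp only [estimate, err, h0, if_neg h]
      rw [← hx]; simp [nextState]
  | succ s ih =>
    intro hs
    have h1 : (s + 1) % (k + 1) = s + 1 := Nat.mod_eq_of_lt (by omega)
    have h0 : (a.plantInfo i k).2.2.1 (Fin.ofNat (k + 1) (s + 1)) = a.2.2.1 i (s + 1) := by
      simp [Path.plantInfo, h1]
    by_cases h : s + 1 + (a.2.2.1 i (s + 1) : ℕ) ≤ k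
    · simp only [estimate, err, h0, if_pos h, PlantInfo.received_plantInfo a i h, add_zero]
    · have hs' : s < k := by omega
      have hu : (a.plantInfo i k).2.2.2 ⟨s, hs'⟩ = a.2.2.2 i s := rfl
      simp only [estimate, err, h0, if_neg h, dif_pos hs', hu]
      conv_rhs => rw [← hx]
      simp only [nextState]
      rw [← ih (by omega), Matrix.mulVec_add]
      abel

theorem measurable_mulVec {a b : ℕ} (M : Matrix (Fin a) (Fin b) ℝ) :
    Measurable fun v : Fin b → ℝ => M *ᵥ v :=
  (Continuous.matrix_mulVec continuous_const continuous_id).measurable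

theorem PlantInfo.measurable_received (i : Fin S.N) (k s : ℕ) :
    Measurable fun I : S.PlantInfo i k => PlantInfo.received I s := by
  have h1 : Measurable (Sum.elim id 0 : S.Packet i → S.State i) :=
    measurable_id.sumElim measurable_const
  have h2 : Measurable fun z : (Fin (k + 1) → S.Link → S.Packet i) × S.Link =>
      z.1 (Fin.ofNat (k + 1) (s + (z.2 : ℕ))) z.2 :=
    measurable_from_prod_countable_left fun d =>
      (measurable_pi_apply d).comp (measurable_pi_apply (Fin.ofNat (k + 1) (s + (d : ℕ))))
  have h3 : Measurable fun I : S.PlantInfo i k => (I.1, I.2.2.1 (Fin.ofNat (k + 1) s)) := by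
    fun_prop
  exact h1.comp (h2.comp h3)

theorem measurable_estimate (i : Fin S.N) (m₀ : S.State i) (k s : ℕ) :
    Measurable fun I : S.PlantInfo i k => estimate i m₀ I s := by
  have hset (s : ℕ) : MeasurableSet
      {I : S.PlantInfo i k | s + (I.2.2.1 (Fin.ofNat (k + 1) s) : ℕ) ≤ k} := by
    have : Measurable fun I : S.PlantInfo i k => I.2.2.1 (Fin.ofNat (k + 1) s) := by fun_prop
    exact this (MeasurableSet.of_discrete (s := {d : S.Link | s + (d : ℕ) ≤ k}))
  induction s with
  | zero =>
    exact Measurable.ite (hset 0) (PlantInfo.measurable_received i k 0) measurable_const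
  | succ s ih =>
    refine Measurable.ite (hset (s + 1)) (PlantInfo.measurable_received i k (s + 1))
      (((measurable_mulVec _).comp ih).add ((measurable_mulVec _).comp ?_))
    split_ifs with h <;> fun_prop

theorem err_congr_grants (i : Fin S.N) (m₀ : S.State i) {k : ℕ} {g h : ℕ → S.Link} (n : S.Seed)
    (hgh : ∀ t ≤ k, g t = h t) (s : ℕ) : err i m₀ k g n s = err i m₀ k h n s := by
  have key (s : ℕ) : s + (g s : ℕ) ≤ k ↔ s + (h s : ℕ) ≤ k := by
    by_cases hs : s ≤ k
    · rw [hgh s hs]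
    · omega
  induction s with
  | zero => simp only [err, key]
  | succ s ih => simp only [err, key, ih]

/-- The first time from which on no state has been received by time `k`. -/
def firstLost (k : ℕ) (g : ℕ → S.Link) : ℕ :=
  ((Finset.range (k + 1)).filter fun s => s + (g s : ℕ) ≤ k).sup (· + 1)

theorem lt_firstLost {k : ℕ} {g : ℕ → S.Link} {s : ℕ} (h : s + (g s : ℕ) ≤ k) :
    s < firstLost k g := by
  have : s + 1 ≤ firstLost k g :=
    Finset.le_sup (f := (· + 1)) (Finset.mem_filter.2 ⟨Finset.mem_range.2 (by omega), h⟩)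
  omega

theorem firstLost_le (k : ℕ) (g : ℕ → S.Link) : firstLost k g ≤ k + 1 := by
  refine Finset.sup_le fun s hs => ?_
  have := Finset.mem_range.1 (Finset.mem_filter.1 hs).1
  omega

theorem received_of_firstLost {k : ℕ} {g : ℕ → S.Link} {s : ℕ} (h : firstLost k g = s + 1) :
    s + (g s : ℕ) ≤ k := by
  have hne : ((Finset.range (k + 1)).filter fun s => s + (g s : ℕ) ≤ k).Nonempty := by
    by_contra hne
    rw [Finset.not_nonempty_iff_eq_empty] at hne
    simp [firstLost, hne] at h
  obtain ⟨r, hr, hr'⟩ := Finset.exists_mem_eq_sup _ hne (· + 1)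
  have : r + 1 = s + 1 := by rw [← h]; exact hr'.symm
  obtain rfl : r = s := by omega
  exact (Finset.mem_filter.1 hr).2

/-- If some state was received, the last one has time `firstLost - 1` and resets the error, so only
later noise remains. If none was, `firstLost` is zero and the whole seed of the plant is late,
including the initial state. Arrivals out of order do no harm, since only the latest sending time
counts. -/
theorem err_congr_seed (i : Fin S.N) (m₀ : S.State i) (k : ℕ) (g : ℕ → S.Link) {n n' : S.Seed}
    (hn : ∀ q ∈ lateSeed i (firstLost k g), n q = n' q) :
    err i m₀ k g n k = err i m₀ k g n' k := by
  suffices ∀ s, firstLost k g ≤ s + 1 → err i m₀ k g n s = err i m₀ k g n' s from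
    this k (firstLost_le k g)
  intro s
  induction s with
  | zero =>
    intro hs
    by_cases h : 0 + (g 0 : ℕ) ≤ k
    · simp only [err, if_pos h]
    · simp only [err, if_neg h]
      rw [hn (i, none)]
      refine ⟨rfl, ?_⟩
      rcases Nat.le_one_iff_eq_zero_or_eq_one.1 hs with h0 | h0
      · simp [h0]
      · exact absurd (received_of_firstLost h0) h
  | succ s ih =>
    intro hs
    by_cases h : s + 1 + (g (s + 1) : ℕ) ≤ k
    · simp only [err, if_pos h]
    · have hlt : firstLost k g ≤ s + 1 := by
        by_contra hc
        exact h (received_of_firstLost (by omega))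
      simp only [err, if_neg h]
      rw [ih hlt, hn (i, some s) ⟨rfl, hlt⟩]

theorem measurable_err (i : Fin S.N) (m₀ : S.State i) (k : ℕ) (g : ℕ → S.Link) (s : ℕ) :
    Measurable fun n => err i m₀ k g n s := by
  induction s with
  | zero => simp only [err]; split_ifs <;> fun_prop
  | succ s ih =>
    simp only [err]
    split_ifs
    · fun_prop
    · exact ((measurable_mulVec _).comp ih).add (by fun_prop)

/-- The counterpart of `err_congr_seed`: the error uses only late seeds, the information only the
others. Only the grants along `a` enter the hypothesis, since those along `b` are forced to coincide
up to time `k`. -/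
theorem plantInfo_congr {p : S.Policies} {n n' : S.Seed} {a b : S.Path}
    (ha : step p n a = a) (hb : step p n' b = b) (i : Fin S.N) (k : ℕ)
    (hn : ∀ q ∉ lateSeed i (firstLost k (a.2.2.1 i)), n q = n' q) :
    a.plantInfo i k = b.plantInfo i k := by
  obtain ⟨h1, h2⟩ := agree_of_eqOn_compl_lateSeed ha hb i _ (k + 1) hn
    (fun s hs => lt_firstLost (by omega)) (k + 1) le_rfl
  refine Prod.ext (funext fun s => funext fun l => ?_)
    (Prod.ext (funext fun s => ?_) (Prod.ext (funext fun s => ?_) (funext fun s => ?_)))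
  · refine packet_congr (g := a.2.2.1 i) (h := b.2.2.1 i)
      (fun r hr => (h1 r (by omega) i).2.1) (fun r hr hr' => ?_) l
    exact h2 r (by omega) i fun _ => lt_firstLost (by omega)
  · exact (h1 s (by omega) i).1
  · exact (h1 s (by omega) i).2.1
  · exact (h1 s (by omega) i).2.2

theorem measurable_path_plantInfo (i : Fin S.N) (k : ℕ) :
    Measurable fun a : S.Path => a.plantInfo i k := by
  refine Measurable.prodMk ?_ (by fun_prop)
  exact measurable_pi_lambda _ fun t => measurable_pi_lambda _ fun d =>
    measurable_packet (fun s => by fun_prop) (fun s => by fun_prop) t d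

end Estimation

/-! ### Random seeds, and closed loops as measurable functions of them. -/

section Probability

variable {S : NCS} {Ω : Type*} [MeasurableSpace Ω] {μ : Measure Ω} {Z : S.Noise μ}

/-- All initial states and noises as a random variable. -/
def Noise.seed (Z : S.Noise μ) (ω : Ω) : S.Seed :=
  fun q => q.2.elim (Z.x₀ q.1) (Z.w q.1) ω

theorem Noise.measurable_seed_apply (Z : S.Noise μ) (q : Fin S.N × Option ℕ) :
    Measurable fun ω => Z.seed ω q := by
  obtain ⟨i, _ | k⟩ := q
  exacts [Z.measurable_x₀ i, Z.measurable_w i k]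

theorem Noise.measurable_seed (Z : S.Noise μ) : Measurable Z.seed :=
  measurable_pi_lambda _ Z.measurable_seed_apply

/-- Functions of disjoint groups of the primitive random variables are independent. -/
theorem Noise.indepFun_of_eqOn (Z : S.Noise μ) (s : Set (Fin S.N × Option ℕ))
    {α β : Type*} [MeasurableSpace α] [MeasurableSpace β] {F : S.Seed → α} {G : S.Seed → β}
    (hF : Measurable F) (hG : Measurable G)
    (hFs : ∀ n n' : S.Seed, (∀ q ∈ s, n q = n' q) → F n = F n')
    (hGs : ∀ n n' : S.Seed, (∀ q ∉ s, n q = n' q) → G n = G n') :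
    IndepFun (fun ω => F (Z.seed ω)) (fun ω => G (Z.seed ω)) μ := by
  classical
  have hind : iIndep (fun q => MeasurableSpace.comap (fun ω => Z.seed ω q) inferInstance) μ :=
    Z.indep.iIndep
  -- Zeroing the irrelevant coordinates does not change `F` or `G`, and it makes them visibly
  -- measurable for the σ-algebras of the two disjoint groups.
  let mask (r : Set (Fin S.N × Option ℕ)) (n : S.Seed) : S.Seed := r.piecewise n 0
  have hmask (r : Set (Fin S.N × Option ℕ)) :
      Measurable[⨆ q ∈ r, MeasurableSpace.comap (fun ω => Z.seed ω q) inferInstance]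
        fun ω => mask r (Z.seed ω) := by
    refine @measurable_pi_lambda _ _ _ (_) _ _ fun q => ?_
    by_cases hq : q ∈ r
    · simp only [mask, Set.piecewise_eq_of_mem _ _ _ hq]
      exact (comap_measurable _).mono (le_iSup₂_of_le q hq le_rfl) le_rfl
    · simp only [mask, Set.piecewise_eq_of_notMem _ _ _ hq]
      exact @measurable_const _ _ _ (_) _
  have hindep := indep_iSup_of_disjoint
    (fun q => (Z.measurable_seed_apply q).comap_le) hind (disjoint_compl_right (a := s))
  rw [IndepFun_iff_Indep]
  refine indep_of_indep_of_le_left (indep_of_indep_of_le_right hindep ?_) ?_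
  · have : (fun ω => G (Z.seed ω)) = fun ω => G (mask sᶜ (Z.seed ω)) :=
      funext fun ω => hGs _ _ fun q hq => by simp [mask, hq]
    rw [this]
    exact (hG.comp (hmask sᶜ)).comap_le
  · have : (fun ω => F (Z.seed ω)) = fun ω => F (mask s (Z.seed ω)) :=
      funext fun ω => hFs _ _ fun q hq => by simp [mask, hq]
    rw [this]
    exact (hF.comp (hmask s)).comap_le

/-- The processes of a closed loop at one outcome. -/
def ClosedLoop.pathAt (e : S.ClosedLoop Z) (ω : Ω) : S.Path :=
  (fun i k => e.x i k ω, fun i k => e.θ i k ω, fun i k => e.ϑ i k ω, fun i k => e.u i k ω)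

theorem ClosedLoop.step_pathAt (e : S.ClosedLoop Z) (ω : Ω) :
    step e.toPolicies (Z.seed ω) (e.pathAt ω) = e.pathAt ω := by
  have hx : nextState (Z.seed ω) (e.pathAt ω) = fun i k => e.x i k ω := by
    funext i k
    cases k with
    | zero => exact (e.x_zero i ω).symm
    | succ k => exact (e.x_succ i k ω).symm
  have hθ : nextRequest e.toPolicies (e.pathAt ω) = fun i k => e.θ i k ω := by
    funext i k
    exact (e.θ_eq i k ω).symm
  have hϑ : nextGrant e.toPolicies (e.pathAt ω) = fun i k => e.ϑ i k ω := by
    funext i k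
    unfold nextGrant
    rw [hθ]
    exact (congrFun (e.ϑ_eq k ω) i).symm
  have hu : nextInput e.toPolicies (Z.seed ω) (e.pathAt ω) = fun i k => e.u i k ω := by
    funext i k
    unfold nextInput
    rw [hθ, hϑ, hx]
    exact (e.u_eq i k ω).symm
  unfold step
  rw [hx, hθ, hϑ, hu]
  rfl

/-- A closed loop is only assumed to satisfy its equations pointwise; uniqueness of the fixed point
makes its processes functions of the seed, from which measurability and independence follow. -/
theorem ClosedLoop.pathAt_eq (e : S.ClosedLoop Z) (ω : Ω) :
    e.pathAt ω = path e.toPolicies (Z.seed ω) :=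
  eq_path (e.step_pathAt ω)

theorem ClosedLoop.measurable_pathAt (e : S.ClosedLoop Z) : Measurable e.pathAt := by
  rw [show e.pathAt = fun ω => path e.toPolicies (Z.seed ω) from funext e.pathAt_eq]
  exact (measurable_path _).comp Z.measurable_seed

theorem ClosedLoop.measurable_ϑ (e : S.ClosedLoop Z) (i : Fin S.N) (k : ℕ) :
    Measurable (e.ϑ i k) := by
  have : Measurable fun a : S.Path => a.2.2.1 i k := by fun_prop
  exact this.comp e.measurable_pathAt

theorem ClosedLoop.measurable_u (e : S.ClosedLoop Z) (i : Fin S.N) (k : ℕ) :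
    Measurable (e.u i k) := by
  have : Measurable fun a : S.Path => a.2.2.2 i k := by fun_prop
  exact this.comp e.measurable_pathAt

theorem ClosedLoop.measurable_plantInfo (e : S.ClosedLoop Z) (i : Fin S.N) (k : ℕ) :
    Measurable (e.plantInfo i k) :=
  (measurable_path_plantInfo i k).comp e.measurable_pathAt

/-- The closed loop generated by given policies. -/
def Policies.closedLoop (p : S.Policies) (Z : S.Noise μ) : S.ClosedLoop Z where
  toPolicies := p
  x i k ω := (path p (Z.seed ω)).1 i k
  θ i k ω := (path p (Z.seed ω)).2.1 i k
  ϑ i k ω := (path p (Z.seed ω)).2.2.1 i k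
  u i k ω := (path p (Z.seed ω)).2.2.2 i k
  x_zero i ω := by rw [← step_path]; rfl
  x_succ i k ω := by conv_lhs => rw [← step_path]
                     rfl
  θ_eq i k ω := by conv_lhs => rw [← step_path]
                   rfl
  ϑ_eq k ω := by
    have h : nextRequest p (path p (Z.seed ω)) = (path p (Z.seed ω)).2.1 :=
      congrArg (fun r => r.2.1) (step_path p (Z.seed ω))
    conv_lhs => rw [← step_path]
    simp only [step, nextGrant, h]
  u_eq i k ω := by
    have h0 : nextState (Z.seed ω) (path p (Z.seed ω)) = (path p (Z.seed ω)).1 :=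
      congrArg (fun r => r.1) (step_path p (Z.seed ω))
    have h1 : nextRequest p (path p (Z.seed ω)) = (path p (Z.seed ω)).2.1 :=
      congrArg (fun r => r.2.1) (step_path p (Z.seed ω))
    have h2 : nextGrant p (path p (Z.seed ω)) = (path p (Z.seed ω)).2.2.1 :=
      congrArg (fun r => r.2.2.1) (step_path p (Z.seed ω))
    conv_lhs => rw [← step_path]
    simp only [step, nextInput, h0, h1, h2]

end Probability

/-! ### Completion of squares along the Riccati recursion. -/

section Riccati

theorem quad_nonneg {l : ℕ} {M : Matrix (Fin l) (Fin l) ℝ} (hM : M.PosSemidef) (v : Fin l → ℝ) :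
    0 ≤ quad M v := by
  simpa [quad] using hM.dotProduct_mulVec_nonneg v

theorem isSymm_of_posSemidef {l : ℕ} {M : Matrix (Fin l) (Fin l) ℝ} (hM : M.PosSemidef) :
    Mᵀ = M := by
  simpa [Matrix.conjTranspose_eq_transpose_of_trivial] using hM.isHermitian.eq

theorem posSemidef_of_quad_nonneg {l : ℕ} {M : Matrix (Fin l) (Fin l) ℝ} (hM : Mᵀ = M)
    (h : ∀ v, 0 ≤ quad M v) : M.PosSemidef := by
  refine Matrix.PosSemidef.of_dotProduct_mulVec_nonneg ?_ fun v => ?_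
  · rw [Matrix.IsHermitian, Matrix.conjTranspose_eq_transpose_of_trivial, hM]
  · simpa [quad] using h v

theorem quad_add {l : ℕ} {M : Matrix (Fin l) (Fin l) ℝ} (hM : Mᵀ = M) (v w : Fin l → ℝ) :
    quad M (v + w) = quad M v + 2 * (v ⬝ᵥ M *ᵥ w) + quad M w := by
  have : w ⬝ᵥ M *ᵥ v = v ⬝ᵥ M *ᵥ w := by
    rw [Matrix.dotProduct_mulVec, ← Matrix.mulVec_transpose, hM, dotProduct_comm]
  simp only [quad, Matrix.mulVec_add, add_dotProduct, dotProduct_add, this]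
  ring

theorem mulVec_dotProduct {a b : ℕ} (M : Matrix (Fin a) (Fin b) ℝ) (v : Fin b → ℝ)
    (w : Fin a → ℝ) : (M *ᵥ v) ⬝ᵥ w = v ⬝ᵥ Mᵀ *ᵥ w := by
  rw [dotProduct_comm, Matrix.dotProduct_mulVec, ← Matrix.mulVec_transpose, dotProduct_comm]

theorem quad_mulVec {a b : ℕ} (P : Matrix (Fin a) (Fin a) ℝ) (M : Matrix (Fin a) (Fin b) ℝ)
    (v : Fin b → ℝ) : quad P (M *ᵥ v) = quad (Mᵀ * P * M) v := by
  simp only [quad, mulVec_dotProduct, Matrix.mulVec_mulVec, Matrix.mul_assoc]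

/-- One step of the Riccati recursion completes the square. -/
theorem quad_completion {a b : ℕ} {A P Q : Matrix (Fin a) (Fin a) ℝ}
    {B : Matrix (Fin a) (Fin b) ℝ} {R M : Matrix (Fin b) (Fin b) ℝ} (hP : Pᵀ = P)
    (hM : Mᵀ = M) (hdet : IsUnit M.det) (hR : M = R + Bᵀ * P * B) (x : Fin a → ℝ)
    (u : Fin b → ℝ) :
    quad Q x + quad R u + quad P (A *ᵥ x + B *ᵥ u) =
      quad (Q + Aᵀ * (P - P * B * M⁻¹ * Bᵀ * P) * A) x +
        quad M (u + (M⁻¹ * Bᵀ * P * A) *ᵥ x) := by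
  have hML : M * (M⁻¹ * Bᵀ * P * A) = Bᵀ * P * A := by
    rw [← Matrix.mul_assoc, ← Matrix.mul_assoc, ← Matrix.mul_assoc, Matrix.mul_nonsing_inv _ hdet,
      Matrix.one_mul]
  have hL : (M⁻¹ * Bᵀ * P * A)ᵀ = Aᵀ * P * B * M⁻¹ := by
    simp only [Matrix.transpose_mul, Matrix.transpose_nonsing_inv, hM, hP,
      Matrix.transpose_transpose, Matrix.mul_assoc]
  rw [quad_add hP, quad_add hM, quad_mulVec, quad_mulVec, quad_mulVec, hL, Matrix.mul_assoc _ M,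
    hML, Matrix.mulVec_mulVec x M, hML]
  have e1 : quad M u = quad R u + quad (Bᵀ * P * B) u := by
    rw [hR]; simp only [quad, Matrix.add_mulVec, dotProduct_add]
  have e2 : (A *ᵥ x) ⬝ᵥ P *ᵥ B *ᵥ u = u ⬝ᵥ (Bᵀ * P * A) *ᵥ x := by
    rw [dotProduct_comm, Matrix.mulVec_mulVec, mulVec_dotProduct, Matrix.mulVec_mulVec,
      Matrix.transpose_mul, hP]
  have e3 : quad (Q + Aᵀ * (P - P * B * M⁻¹ * Bᵀ * P) * A) x =
      quad Q x + quad (Aᵀ * P * A) x - quad (Aᵀ * P * B * M⁻¹ * (Bᵀ * P * A)) x := by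
    simp only [quad, Matrix.add_mulVec, dotProduct_add, Matrix.mul_sub, Matrix.sub_mul,
      Matrix.sub_mulVec, dotProduct_sub, Matrix.mul_assoc]
    ring
  rw [e1, e2, e3]
  ring

variable (S : NCS) (i : Fin S.N)

/-- The weight of the deviation of the input from the LQR law at time `k`. -/
def inputWeight (k : ℕ) : Matrix (Fin (S.m i)) (Fin (S.m i)) ℝ :=
  S.R i + (S.B i)ᵀ * S.riccati i (k + 1) * S.B i

variable {S} in
theorem posDef_add_congruence {P : Matrix (Fin (S.n i)) (Fin (S.n i)) ℝ} (hP : P.PosSemidef) :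
    (S.R i + (S.B i)ᵀ * P * S.B i).PosDef := by
  refine (S.R_posDef i).add_posSemidef ?_
  simpa [Matrix.conjTranspose_eq_transpose_of_trivial] using
    hP.conjTranspose_mul_mul_same (S.B i)

/-- At the input that makes the completed square vanish, the new quadratic form is a sum of
nonnegative costs. -/
theorem riccatiToGo_posSemidef (j : ℕ) : (S.riccatiToGo i j).PosSemidef := by
  induction j with
  | zero => exact S.Q₂_posSemidef i
  | succ j ih =>
    have hM := posDef_add_congruence i ih
    have hMt := isSymm_of_posSemidef hM.posSemidef
    have hPt := isSymm_of_posSemidef ih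
    have hQt := isSymm_of_posSemidef (S.Q₁_posSemidef i)
    refine posSemidef_of_quad_nonneg ?_ fun x => ?_
    · simp only [riccatiToGo, Matrix.transpose_add, Matrix.transpose_mul, Matrix.transpose_sub,
        Matrix.transpose_transpose, hQt, hPt, Matrix.transpose_nonsing_inv, Matrix.mul_assoc]
      rw [isSymm_of_posSemidef (S.R_posDef i).posSemidef]
    · have := quad_completion (A := S.A i) (B := S.B i) (Q := S.Q₁ i) hPt hMt hM.det_pos.ne'.isUnit
        rfl x (-(((S.R i + (S.B i)ᵀ * S.riccatiToGo i j * S.B i)⁻¹ * (S.B i)ᵀ *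
          S.riccatiToGo i j * S.A i) *ᵥ x))
      rw [neg_add_cancel] at this
      have h0 : quad (S.R i + (S.B i)ᵀ * S.riccatiToGo i j * S.B i) 0 = 0 := by simp [quad]
      rw [h0, add_zero] at this
      change 0 ≤ quad (S.Q₁ i + _) x
      rw [← this]
      have h1 := quad_nonneg (S.Q₁_posSemidef i) x
      have h2 := quad_nonneg (S.R_posDef i).posSemidef
      have h3 := quad_nonneg ih
      exact add_nonneg (add_nonneg h1 (h2 _)) (h3 _)

theorem riccati_posSemidef (k : ℕ) : (S.riccati i k).PosSemidef := S.riccatiToGo_posSemidef i _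

theorem inputWeight_posDef (k : ℕ) : (S.inputWeight i k).PosDef :=
  posDef_add_congruence i (S.riccati_posSemidef i (k + 1))

theorem quad_stage {k : ℕ} (hk : k < S.T) (x : S.State i) (u : S.Input i) :
    quad (S.Q₁ i) x + quad (S.R i) u + quad (S.riccati i (k + 1)) (S.A i *ᵥ x + S.B i *ᵥ u) =
      quad (S.riccati i k) x + quad (S.inputWeight i k) (u + S.gain i k *ᵥ x) := by
  have h : S.riccati i k = S.Q₁ i + (S.A i)ᵀ * (S.riccati i (k + 1) - S.riccati i (k + 1) * S.B i *
      (S.inputWeight i k)⁻¹ * (S.B i)ᵀ * S.riccati i (k + 1)) * S.A i := by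
    unfold inputWeight riccati
    rw [show S.T - k = S.T - (k + 1) + 1 by omega]
    rfl
  rw [h]
  exact quad_completion (isSymm_of_posSemidef (S.riccati_posSemidef i (k + 1)))
    (isSymm_of_posSemidef (S.inputWeight_posDef i k).posSemidef)
    (S.inputWeight_posDef i k).det_pos.ne'.isUnit rfl x u

/-- The stage costs telescope along a trajectory of the plant. -/
theorem quad_telescope (x : ℕ → S.State i) (u : ℕ → S.Input i) (w : ℕ → S.State i)
    (hx : ∀ k, x (k + 1) = S.A i *ᵥ x k + S.B i *ᵥ u k + w k) :
    quad (S.Q₂ i) (x S.T) +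
        ∑ k ∈ Finset.range S.T, (quad (S.Q₁ i) (x k) + quad (S.R i) (u k)) =
      quad (S.riccati i 0) (x 0) + ∑ k ∈ Finset.range S.T,
        (quad (S.inputWeight i k) (u k + S.gain i k *ᵥ x k) +
          2 * ((S.A i *ᵥ x k + S.B i *ᵥ u k) ⬝ᵥ S.riccati i (k + 1) *ᵥ w k) +
          quad (S.riccati i (k + 1)) (w k)) := by
  have h := Finset.sum_range_sub (fun k => quad (S.riccati i k) (x k)) S.T
  have hT : S.riccati i S.T = S.Q₂ i := by simp [riccati, riccatiToGo]
  rw [hT] at h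
  have hs : ∀ k ∈ Finset.range S.T, quad (S.Q₁ i) (x k) + quad (S.R i) (u k) =
      (quad (S.inputWeight i k) (u k + S.gain i k *ᵥ x k) +
          2 * ((S.A i *ᵥ x k + S.B i *ᵥ u k) ⬝ᵥ S.riccati i (k + 1) *ᵥ w k) +
          quad (S.riccati i (k + 1)) (w k)) -
        (quad (S.riccati i (k + 1)) (x (k + 1)) - quad (S.riccati i k) (x k)) := by
    intro k hk
    have h1 := S.quad_stage i (Finset.mem_range.1 hk) (x k) (u k)
    rw [hx k, quad_add (isSymm_of_posSemidef (S.riccati_posSemidef i (k + 1)))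
      (S.A i *ᵥ x k + S.B i *ᵥ u k) (w k)]
    linarith
  rw [Finset.sum_congr rfl hs, Finset.sum_sub_distrib, h]
  ring

end Riccati

/-! ### Square integrability of vectors and quadratic forms. -/

section Moments

variable {Ω : Type*} [MeasurableSpace Ω] {μ : Measure Ω}

theorem memLp_mulVec {a b : ℕ} (M : Matrix (Fin a) (Fin b) ℝ) {f : Ω → Fin b → ℝ}
    (hf : MemLp f 2 μ) : MemLp (fun ω => M *ᵥ f ω) 2 μ :=
  (M.mulVecLin.toContinuousLinearMap).comp_memLp' hf

theorem integral_mulVec {a b : ℕ} (M : Matrix (Fin a) (Fin b) ℝ) {f : Ω → Fin b → ℝ}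
    (hf : Integrable f μ) : ∫ ω, M *ᵥ f ω ∂μ = M *ᵥ ∫ ω, f ω ∂μ :=
  (M.mulVecLin.toContinuousLinearMap).integral_comp_comm hf

theorem integrable_dotProduct {a : ℕ} {f g : Ω → Fin a → ℝ} (hf : MemLp f 2 μ)
    (hg : MemLp g 2 μ) : Integrable (fun ω => f ω ⬝ᵥ g ω) μ := by
  simp only [dotProduct]
  exact integrable_finsetSum _ fun j _ => (hf.eval j).integrable_mul (hg.eval j)

theorem integrable_quad {a : ℕ} (M : Matrix (Fin a) (Fin a) ℝ) {f : Ω → Fin a → ℝ}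
    (hf : MemLp f 2 μ) : Integrable (fun ω => quad M (f ω)) μ :=
  integrable_dotProduct hf (memLp_mulVec M hf)

theorem integral_dotProduct_eq_zero {a : ℕ} {f g : Ω → Fin a → ℝ} (hf : MemLp f 2 μ)
    (hg : MemLp g 2 μ) (h : ∀ j, ∫ ω, f ω j * g ω j ∂μ = 0) : ∫ ω, f ω ⬝ᵥ g ω ∂μ = 0 := by
  simp only [dotProduct]
  exact (integral_finsetSum _ fun j _ => (hf.eval j).integrable_mul (hg.eval j)).trans
    (Finset.sum_eq_zero fun j _ => h j)

theorem measurable_quad {a : ℕ} (M : Matrix (Fin a) (Fin a) ℝ) :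
    Measurable fun v : Fin a → ℝ => quad M v := by
  have : Continuous fun v : Fin a → ℝ => quad M v :=
    continuous_id.dotProduct (Continuous.matrix_mulVec continuous_const continuous_id)
  exact this.measurable

end Moments

/-! ### Independence of the estimation error from the plant information. -/

section Decoupling

variable {S : NCS} {Ω : Type*} [MeasurableSpace Ω] {μ : Measure Ω} {Z : S.Noise μ}

/-- Gaussian measures have second moments. The law lives on Euclidean space while states carry the
sup norm, hence the passage through coordinates. -/
theorem Noise.memLp_w (Z : S.Noise μ) (i : Fin S.N) (k : ℕ) : MemLp (Z.w i k) 2 μ := by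
  have h := Z.law_w i k
  have h1 : MemLp (fun ω => WithLp.toLp 2 (Z.w i k ω)) 2 μ := by
    have h2 : MemLp id 2 (μ.map fun ω => WithLp.toLp 2 (Z.w i k ω)) := by
      rw [h.map_eq]; exact IsGaussian.memLp_two_id
    exact (memLp_map_measure_iff aestronglyMeasurable_id h.aemeasurable).1 h2
  exact memLp_pi_iff.2 fun j => h1.eval_piLp j

/-- The mean of the initial state. -/
def Noise.mean (Z : S.Noise μ) (i : Fin S.N) : S.State i := ∫ ω, Z.x₀ i ω ∂μ

/-- The estimate of the current state. -/
def ClosedLoop.est (e : S.ClosedLoop Z) (i : Fin S.N) (k : ℕ) (ω : Ω) : S.State i :=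
  estimate i (Z.mean i) (e.plantInfo i k ω) k

/-- The error of the estimate of the current state. -/
def ClosedLoop.estErr (e : S.ClosedLoop Z) (i : Fin S.N) (k : ℕ) (ω : Ω) : S.State i :=
  err i (Z.mean i) k (fun t => e.ϑ i t ω) (Z.seed ω) k

theorem ClosedLoop.est_add_estErr (e : S.ClosedLoop Z) (i : Fin S.N) (k : ℕ) (ω : Ω) :
    e.est i k ω + e.estErr i k ω = e.x i k ω :=
  estimate_add_err (e.step_pathAt ω) i (Z.mean i) k k le_rfl

theorem firstLost_congr {k : ℕ} {g h : ℕ → S.Link} (hgh : ∀ t ≤ k, g t = h t) :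
    firstLost k g = firstLost k h := by
  unfold firstLost
  congr 1
  refine Finset.filter_congr fun s hs => ?_
  rw [hgh s (by have := Finset.mem_range.1 hs; omega)]

/-- Extension of a finite sequence of grants. -/
def extend {k : ℕ} (h : Fin (k + 1) → S.Link) (t : ℕ) : S.Link := h (Fin.ofNat (k + 1) t)

theorem extend_apply {k t : ℕ} (ht : t ≤ k) (g : ℕ → S.Link) :
    extend (fun s : Fin (k + 1) => g s) t = g t := by
  simp [extend, Nat.mod_eq_of_lt (Nat.lt_succ_of_le ht)]

/-- The lost noise is independent of the plant information on each event of given grants. -/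
theorem ClosedLoop.indepFun_err (e : S.ClosedLoop Z) (i : Fin S.N) (k : ℕ)
    (h : Fin (k + 1) → S.Link) {B : Set (S.PlantInfo i k)} (hB : MeasurableSet B) :
    IndepFun (fun ω => (B ∩ {I | I.2.2.1 = h}).indicator (fun _ => (1 : ℝ)) (e.plantInfo i k ω))
      (fun ω => err i (Z.mean i) k (extend h) (Z.seed ω) k) μ := by
  have hB' : MeasurableSet (B ∩ {I : S.PlantInfo i k | I.2.2.1 = h}) := by
    refine hB.inter ?_
    have : Measurable fun I : S.PlantInfo i k => I.2.2.1 := by fun_prop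
    exact this (measurableSet_singleton h)
  have hpi (ω : Ω) : e.plantInfo i k ω = (path e.toPolicies (Z.seed ω)).plantInfo i k := by
    rw [← e.pathAt_eq]; rfl
  simp only [hpi]
  refine (Z.indepFun_of_eqOn (lateSeed i (firstLost k (extend h)))
    (measurable_err i (Z.mean i) k (extend h) k)
    (((measurable_const (a := (1 : ℝ))).indicator hB').comp
      ((measurable_path_plantInfo i k).comp (measurable_path e.toPolicies)))
    (fun n n' hn => err_congr_seed i _ k _ hn) ?_).symm
  -- If one of the two seeds produces the grants `h`, so does the other, with the same information;
  -- so even the event of these grants ignores the late seeds.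
  have key (n n' : S.Seed) (hn : ∀ q ∉ lateSeed i (firstLost k (extend h)), n q = n' q)
      (hI : ((path e.toPolicies n).plantInfo i k).2.2.1 = h) :
      (path e.toPolicies n).plantInfo i k = (path e.toPolicies n').plantInfo i k := by
    refine plantInfo_congr (step_path _ n) (step_path _ n') i k ?_
    rwa [← firstLost_congr (g := extend h)]
    intro t ht
    rw [← hI]
    exact extend_apply ht ((path e.toPolicies n).2.2.1 i)
  intro n n' hn
  simp only [Function.comp_apply]
  by_cases h1 : ((path e.toPolicies n).plantInfo i k).2.2.1 = h
  · rw [key n n' hn h1]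
  by_cases h2 : ((path e.toPolicies n').plantInfo i k).2.2.1 = h
  · rw [key n' n (fun q hq => (hn q hq).symm) h2]
  · rw [Set.indicator_of_notMem fun hc => h1 hc.2, Set.indicator_of_notMem fun hc => h2 hc.2]

/-- Splits an expression in random grants over the finitely many grant histories; on each piece the
grants are constant, so the independence above applies. -/
theorem ClosedLoop.indicator_eq_sum (e : S.ClosedLoop Z) (i : Fin S.N) (k : ℕ)
    {E : Type*} [AddCommMonoid E] (Ψ : (ℕ → S.Link) → Ω → E)
    (hΨ : ∀ g h : ℕ → S.Link, (∀ t ≤ k, g t = h t) → Ψ g = Ψ h) (B : Set (S.PlantInfo i k)) :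
    (e.plantInfo i k ⁻¹' B).indicator (fun ω => Ψ (fun t => e.ϑ i t ω) ω) =
      fun ω => ∑ h : Fin (k + 1) → S.Link,
        (e.plantInfo i k ⁻¹' (B ∩ {I | I.2.2.1 = h})).indicator (Ψ (extend h)) ω := by
  funext ω
  have hg : (e.plantInfo i k ω).2.2.1 = fun t : Fin (k + 1) => e.ϑ i t ω := rfl
  rw [Finset.sum_eq_single (fun t : Fin (k + 1) => e.ϑ i t ω)]
  · by_cases hB : e.plantInfo i k ω ∈ B
    · have h1 : ω ∈ e.plantInfo i k ⁻¹' B := hB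
      have h2 : ω ∈ e.plantInfo i k ⁻¹' (B ∩ {I | I.2.2.1 = fun t : Fin (k + 1) => e.ϑ i t ω}) :=
        ⟨hB, hg⟩
      rw [Set.indicator_of_mem h1, Set.indicator_of_mem h2]
      rw [hΨ _ _ fun t ht => extend_apply ht (fun t => e.ϑ i t ω)]
    · have h1 : ω ∉ e.plantInfo i k ⁻¹' B := hB
      have h2 : ω ∉ e.plantInfo i k ⁻¹' (B ∩ {I | I.2.2.1 = fun t : Fin (k + 1) => e.ϑ i t ω}) :=
        fun h => hB h.1
      rw [Set.indicator_of_notMem h1, Set.indicator_of_notMem h2]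
  · intro h _ hne
    exact Set.indicator_of_notMem (fun hc => hne (hc.2.symm.trans hg)) _
  · simp

theorem ClosedLoop.measurableSet_plantInfo_inter (e : S.ClosedLoop Z) (i : Fin S.N) (k : ℕ)
    {B : Set (S.PlantInfo i k)} (hB : MeasurableSet B) (h : Fin (k + 1) → S.Link) :
    MeasurableSet (e.plantInfo i k ⁻¹' (B ∩ {I | I.2.2.1 = h})) := by
  refine e.measurable_plantInfo i k (hB.inter ?_)
  have : Measurable fun I : S.PlantInfo i k => I.2.2.1 := by fun_prop
  exact this (measurableSet_singleton h)

theorem ClosedLoop.plantSigma_le (e : S.ClosedLoop Z) (i : Fin S.N) (k : ℕ) :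
    e.plantSigma i k ≤ (inferInstance : MeasurableSpace Ω) :=
  (e.measurable_plantInfo i k).comap_le

theorem ClosedLoop.measurable_est (e : S.ClosedLoop Z) (i : Fin S.N) (k : ℕ) :
    Measurable[e.plantSigma i k] (e.est i k) :=
  (measurable_estimate i (Z.mean i) k k).comp (comap_measurable (e.plantInfo i k))

theorem ClosedLoop.measurable_u_plantSigma (e : S.ClosedLoop Z) (i : Fin S.N) (k : ℕ) :
    Measurable[e.plantSigma i k] (e.u i k) := by
  have : e.u i k = fun ω => e.γ i k (e.plantInfo i k ω) := funext fun ω => e.u_eq i k ω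
  rw [this]
  exact (e.measurable_γ i k).comp (comap_measurable (e.plantInfo i k))

/-- The current noise is independent of the current state and input. -/
theorem ClosedLoop.indepFun_w (e : S.ClosedLoop Z) (i : Fin S.N) (k : ℕ) :
    IndepFun (Z.w i k) (fun ω => (e.x i k ω, e.u i k ω)) μ := by
  have hp (ω : Ω) : (e.x i k ω, e.u i k ω) =
      ((path e.toPolicies (Z.seed ω)).1 i k, (path e.toPolicies (Z.seed ω)).2.2.2 i k) := by
    rw [← e.pathAt_eq]; rfl
  simp only [hp]
  refine Z.indepFun_of_eqOn (lateSeed i (k + 1)) (F := fun n => n (i, some k))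
    (G := fun n => ((path e.toPolicies n).1 i k, (path e.toPolicies n).2.2.2 i k))
    (by fun_prop) ?_ (fun n n' hn => hn _ ⟨rfl, le_rfl⟩) fun n n' hn => ?_
  · have : Measurable fun a : S.Path => (a.1 i k, a.2.2.2 i k) := by fun_prop
    exact this.comp (measurable_path e.toPolicies)
  -- With `c = K = k + 1` the condition on received states is plain causality, for any grants.
  · obtain ⟨h1, h2⟩ := agree_of_eqOn_compl_lateSeed (step_path e.toPolicies n)
      (step_path e.toPolicies n') i (k + 1) (k + 1) hn (fun s hs => by omega) (k + 1) le_rfl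
    simp only [h2 k (by omega) i (fun _ => by omega), (h1 k (by omega) i).2.2]

theorem ClosedLoop.memLp_comp_estErr (e : S.ClosedLoop Z) (i : Fin S.N) (k : ℕ) {r : ℝ≥0∞}
    {E : Type*} [NormedAddCommGroup E]
    (φ : S.State i → E)
    (hφ : ∀ g, MemLp (fun ω => φ (err i (Z.mean i) k g (Z.seed ω) k)) r μ) :
    MemLp (fun ω => φ (e.estErr i k ω)) r μ := by
  have h := e.indicator_eq_sum i k (fun g ω => φ (err i (Z.mean i) k g (Z.seed ω) k))
    (fun g h hgh => funext fun ω => by rw [err_congr_grants i _ _ hgh]) Set.univ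
  rw [Set.preimage_univ, Set.indicator_univ] at h
  simp only [estErr]
  rw [h]
  exact memLp_finsetSum _ fun h _ =>
    (hφ _).indicator (e.measurableSet_plantInfo_inter i k MeasurableSet.univ h)

variable [IsProbabilityMeasure μ]

theorem Noise.integral_w (Z : S.Noise μ) (i : Fin S.N) (k : ℕ) : ∫ ω, Z.w i k ω ∂μ = 0 := by
  have h := (Z.law_w i k).integral_eq
  rw [integral_id_multivariateGaussian] at h
  have h1 := ((PiLp.continuousLinearEquiv 2 ℝ fun _ : Fin (S.n i) => ℝ).symm :
    (Fin (S.n i) → ℝ) →L[ℝ] EuclideanSpace ℝ (Fin (S.n i))).integral_comp_comm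
      ((Z.memLp_w i k).integrable one_le_two)
  have h2 : WithLp.toLp 2 (∫ ω, Z.w i k ω ∂μ) = 0 := h1.symm.trans h
  simpa using h2

theorem Noise.memLp_err (Z : S.Noise μ) (i : Fin S.N) (k : ℕ) (g : ℕ → S.Link) (s : ℕ) :
    MemLp (fun ω => err i (Z.mean i) k g (Z.seed ω) s) 2 μ := by
  induction s with
  | zero =>
    simp only [err]
    split_ifs
    · exact MemLp.zero'
    · exact (Z.memLp_x₀ i).sub (memLp_const _)
  | succ s ih =>
    simp only [err]
    split_ifs
    · exact MemLp.zero'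
    · exact (memLp_mulVec _ ih).add (Z.memLp_w i s)

theorem Noise.integral_err (Z : S.Noise μ) (i : Fin S.N) (k : ℕ) (g : ℕ → S.Link) (s : ℕ) :
    ∫ ω, err i (Z.mean i) k g (Z.seed ω) s ∂μ = 0 := by
  induction s with
  | zero =>
    simp only [err]
    split_ifs
    · simp
    · have h : ∫ ω, (Z.x₀ i ω - Z.mean i) ∂μ = 0 := by
        rw [integral_sub ((Z.memLp_x₀ i).integrable one_le_two) (integrable_const _)]
        simp [Noise.mean]
      exact h
  | succ s ih =>
    simp only [err]
    split_ifs
    · simp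
    · have h1 := Z.memLp_err i k g s
      have h : ∫ ω, (S.A i *ᵥ err i (Z.mean i) k g (Z.seed ω) s + Z.w i s ω) ∂μ = 0 := by
        rw [integral_add ((memLp_mulVec _ h1).integrable one_le_two)
          ((Z.memLp_w i s).integrable one_le_two),
          integral_mulVec _ (h1.integrable one_le_two), ih, Z.integral_w]
        simp
      exact h

section

variable {E : Type*} [NormedAddCommGroup E] [NormedSpace ℝ E] [MeasurableSpace E] [BorelSpace E]
  [CompleteSpace E]

/-- Given the plant information, functions of the estimation error have the mean that they would
have under deterministic grants. -/
theorem ClosedLoop.setIntegral_comp_estErr (e : S.ClosedLoop Z) (i : Fin S.N) (k : ℕ)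
    {φ : S.State i → E} (hφm : Measurable φ)
    (hφ : ∀ g, Integrable (fun ω => φ (err i (Z.mean i) k g (Z.seed ω) k)) μ)
    {B : Set (S.PlantInfo i k)} (hB : MeasurableSet B) :
    ∫ ω in e.plantInfo i k ⁻¹' B, φ (e.estErr i k ω) ∂μ =
      ∫ ω in e.plantInfo i k ⁻¹' B,
        (∫ ω', φ (err i (Z.mean i) k (fun t => e.ϑ i t ω) (Z.seed ω') k) ∂μ) ∂μ := by
  have h1 := e.indicator_eq_sum i k (fun g ω => φ (err i (Z.mean i) k g (Z.seed ω) k))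
    (fun g h hgh => funext fun ω => by rw [err_congr_grants i _ _ hgh]) B
  have h2 := e.indicator_eq_sum i k
    (fun g _ => ∫ ω', φ (err i (Z.mean i) k g (Z.seed ω') k) ∂μ)
    (fun g h hgh => funext fun ω => by simp only [err_congr_grants i _ _ hgh]) B
  have hs (h) := e.measurableSet_plantInfo_inter i k hB h
  rw [← integral_indicator (e.measurable_plantInfo i k hB),
    ← integral_indicator (e.measurable_plantInfo i k hB)]
  simp only [estErr]
  rw [h1, h2, integral_finsetSum _ fun h _ => (hφ _).indicator (hs h),
    integral_finsetSum _ fun h _ => (integrable_const _).indicator (hs h)]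
  refine Finset.sum_congr rfl fun h _ => ?_
  have hind := (e.indepFun_err i k h hB).comp measurable_id hφm
  have hm : Measurable fun ω =>
      (B ∩ {I : S.PlantInfo i k | I.2.2.1 = h}).indicator (fun _ => (1 : ℝ))
        (e.plantInfo i k ω) :=
    (measurable_const (a := (1 : ℝ))).indicator (hs h)
  have := hind.integral_fun_smul_eq_smul_integral hm.aestronglyMeasurable
    (hφ (extend h)).aestronglyMeasurable
  have e1 : (fun ω => (e.plantInfo i k ⁻¹' (B ∩ {I | I.2.2.1 = h})).indicator
      (fun ω => φ (err i (Z.mean i) k (extend h) (Z.seed ω) k)) ω) = fun ω =>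
      (B ∩ {I : S.PlantInfo i k | I.2.2.1 = h}).indicator (fun _ => (1 : ℝ))
        (e.plantInfo i k ω) • φ (err i (Z.mean i) k (extend h) (Z.seed ω) k) := by
    funext ω
    by_cases hω : e.plantInfo i k ω ∈ B ∩ {I | I.2.2.1 = h}
    · rw [Set.indicator_of_mem hω, Set.indicator_of_mem (by exact hω), one_smul]
    · rw [Set.indicator_of_notMem hω, Set.indicator_of_notMem (by exact hω), zero_smul]
  rw [e1]
  refine this.trans ?_
  rw [integral_indicator (hs h), setIntegral_const]
  congr 1
  have e2 : (fun ω => (id ∘ fun ω => (B ∩ {I : S.PlantInfo i k | I.2.2.1 = h}).indicator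
      (fun _ => (1 : ℝ)) (e.plantInfo i k ω)) ω) =
      (e.plantInfo i k ⁻¹' (B ∩ {I | I.2.2.1 = h})).indicator (fun _ => (1 : ℝ)) := rfl
  rw [e2, integral_indicator (hs h), setIntegral_const]
  simp

theorem ClosedLoop.memLp_estErr (e : S.ClosedLoop Z) (i : Fin S.N) (k : ℕ) :
    MemLp (e.estErr i k) 2 μ :=
  e.memLp_comp_estErr i k id fun g => Z.memLp_err i k g k

/-- The error is centred under every deterministic grant sequence, hence integrates to zero over
each event of the plant information. The identity map gives the conditional mean of the state,
scalar functionals give orthogonality. -/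
theorem ClosedLoop.condExp_clm_estErr (e : S.ClosedLoop Z) (i : Fin S.N)
    (k : ℕ) (ℓ : S.State i →L[ℝ] E) :
    μ[fun ω => ℓ (e.estErr i k ω) | e.plantSigma i k] =ᵐ[μ] 0 := by
  symm
  refine ae_eq_condExp_of_forall_setIntegral_eq (e.plantSigma_le i k)
    (ℓ.integrable_comp ((e.memLp_estErr i k).integrable one_le_two))
    (fun s _ _ => integrableOn_zero) ?_ aestronglyMeasurable_zero
  rintro s ⟨B, hB, rfl⟩ -
  rw [e.setIntegral_comp_estErr i k ℓ.continuous.measurable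
    (fun g => ℓ.integrable_comp ((Z.memLp_err i k g k).integrable one_le_two)) hB]
  have (g : ℕ → S.Link) : ∫ ω', ℓ (err i (Z.mean i) k g (Z.seed ω') k) ∂μ = 0 := by
    rw [ℓ.integral_comp_comm ((Z.memLp_err i k g k).integrable one_le_two), Z.integral_err,
      map_zero]
  simp [this]

end

theorem ClosedLoop.integral_mul_clm_estErr (e : S.ClosedLoop Z) (i : Fin S.N) (k : ℕ)
    (ℓ : S.State i →L[ℝ] ℝ) {f : Ω → ℝ} (hf : StronglyMeasurable[e.plantSigma i k] f)
    (hf2 : MemLp f 2 μ) : ∫ ω, f ω * ℓ (e.estErr i k ω) ∂μ = 0 := by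
  have h2 : MemLp (fun ω => ℓ (e.estErr i k ω)) 2 μ := ℓ.comp_memLp' (e.memLp_estErr i k)
  have h := condExp_mul_of_stronglyMeasurable_left hf (hf2.integrable_mul h2)
    (h2.integrable one_le_two)
  have h0 : μ[f * fun ω => ℓ (e.estErr i k ω) | e.plantSigma i k] =ᵐ[μ] 0 := by
    filter_upwards [h, e.condExp_clm_estErr i k ℓ] with ω h3 h4
    rw [h3, Pi.mul_apply, h4]
    simp
  have := integral_condExp (μ := μ) (e.plantSigma_le i k)
    (f := f * fun ω => ℓ (e.estErr i k ω))
  rw [integral_congr_ae h0] at this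
  simpa using this.symm

/-- The estimate is the conditional mean. -/
theorem ClosedLoop.condExp_x (e : S.ClosedLoop Z) (i : Fin S.N) (k : ℕ)
    (hx : MemLp (e.x i k) 2 μ) : μ[e.x i k | e.plantSigma i k] =ᵐ[μ] e.est i k := by
  have herr := e.memLp_estErr i k
  have hest : MemLp (e.est i k) 2 μ := by
    have : e.est i k = e.x i k - e.estErr i k := by
      funext ω; rw [Pi.sub_apply, ← e.est_add_estErr]; simp
    rw [this]; exact hx.sub herr
  have h : e.x i k = e.est i k + e.estErr i k := funext fun ω => (e.est_add_estErr i k ω).symm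
  have h1 := condExp_add (hest.integrable one_le_two) (herr.integrable one_le_two)
    (e.plantSigma i k)
  have h2 := condExp_of_stronglyMeasurable (e.plantSigma_le i k)
    (e.measurable_est i k).stronglyMeasurable (hest.integrable one_le_two)
  have h3 := e.condExp_clm_estErr i k (ContinuousLinearMap.id ℝ _)
  rw [h]
  filter_upwards [h1, h3] with ω h4 h5
  rw [h4, Pi.add_apply, h2]
  have h6 : (μ[e.estErr i k | e.plantSigma i k]) ω = 0 := h5
  rw [h6, add_zero]

/-- The current noise is centred and independent of the current state and input, so the cross terms
of the telescoped cost vanish in the mean. -/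
theorem ClosedLoop.integral_dotProduct_w (e : S.ClosedLoop Z) (i : Fin S.N) (k : ℕ)
    {f : S.State i × S.Input i → S.State i} (hf : Measurable f)
    (hf2 : MemLp (fun ω => f (e.x i k ω, e.u i k ω)) 2 μ)
    (M : Matrix (Fin (S.n i)) (Fin (S.n i)) ℝ) :
    ∫ ω, f (e.x i k ω, e.u i k ω) ⬝ᵥ M *ᵥ Z.w i k ω ∂μ = 0 := by
  have hw := memLp_mulVec M (Z.memLp_w i k)
  refine integral_dotProduct_eq_zero hf2 hw fun j => ?_
  have h := (e.indepFun_w i k).symm.comp ((measurable_pi_apply j).comp hf)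
    ((measurable_pi_apply j).comp (measurable_mulVec M))
  have h1 := h.integral_fun_mul_eq_mul_integral (hf2.eval j).aestronglyMeasurable
    (hw.eval j).aestronglyMeasurable
  have h2 : ∫ ω, (M *ᵥ Z.w i k ω) j ∂μ = 0 := by
    have h3 := (ContinuousLinearMap.proj (R := ℝ) (φ := fun _ : Fin (S.n i) => ℝ) j).integral_comp_comm
      (hw.integrable one_le_two)
    rw [integral_mulVec M ((Z.memLp_w i k).integrable one_le_two), Z.integral_w,
      Matrix.mulVec_zero, map_zero] at h3
    exact h3
  refine h1.trans ?_
  simp only [Function.comp_def]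
  rw [h2, mul_zero]

end Decoupling

/-! ### Coercivity of positive definite forms. -/

section Coercive

theorem quad_pos {l : ℕ} {M : Matrix (Fin l) (Fin l) ℝ} (hM : M.PosDef) {v : Fin l → ℝ}
    (hv : v ≠ 0) : 0 < quad M v := by
  simpa [quad] using hM.dotProduct_mulVec_pos hv

theorem exists_mul_sq_norm_le_quad {l : ℕ} {M : Matrix (Fin l) (Fin l) ℝ} (hM : M.PosDef) :
    ∃ c > 0, ∀ v : Fin l → ℝ, c * ‖v‖ ^ 2 ≤ quad M v := by
  have hcont : Continuous fun v : Fin l → ℝ => quad M v :=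
    continuous_id.dotProduct (Continuous.matrix_mulVec continuous_const continuous_id)
  have hsmul (r : ℝ) (v : Fin l → ℝ) : quad M (r • v) = r ^ 2 * quad M v := by
    simp only [quad, Matrix.mulVec_smul, smul_dotProduct, dotProduct_smul, smul_eq_mul]
    ring
  have hz : quad M (0 : Fin l → ℝ) = 0 := by simp [quad]
  rcases (Metric.sphere (0 : Fin l → ℝ) 1).eq_empty_or_nonempty with he | hne
  -- An empty unit sphere means dimension zero, where any constant works; otherwise the minimum over
  -- the sphere is taken.
  · refine ⟨1, one_pos, fun v => ?_⟩
    have hv : v = 0 := by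
      by_contra hv
      have : (‖v‖⁻¹ • v) ∈ Metric.sphere (0 : Fin l → ℝ) 1 := by
        simp [norm_smul, norm_ne_zero_iff.2 hv]
      simp [he] at this
    simp [hv, hz]
  · obtain ⟨v₀, hv₀, hmin⟩ := (isCompact_sphere (0 : Fin l → ℝ) 1).exists_isMinOn hne
      hcont.continuousOn
    have hv₀' : v₀ ≠ 0 := by
      rintro rfl
      simp at hv₀
    refine ⟨quad M v₀, quad_pos hM hv₀', fun v => ?_⟩
    by_cases hv : v = 0
    · simp [hv, hz]
    · have h1 : (‖v‖⁻¹ • v) ∈ Metric.sphere (0 : Fin l → ℝ) 1 := by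
        simp [norm_smul, norm_ne_zero_iff.2 hv]
      have h2 : quad M v₀ ≤ quad M (‖v‖⁻¹ • v) := hmin h1
      have h3 : 0 < ‖v‖ := norm_pos_iff.2 hv
      rw [hsmul, inv_pow, ← div_eq_inv_mul, le_div_iff₀ (by positivity)] at h2
      exact h2

theorem memLp_of_lintegral_quad_ne_top {Ω : Type*} [MeasurableSpace Ω] {μ : Measure Ω} {l : ℕ}
    {M : Matrix (Fin l) (Fin l) ℝ} (hM : M.PosDef) {f : Ω → Fin l → ℝ} (hf : Measurable f)
    (h : ∫⁻ ω, ENNReal.ofReal (quad M (f ω)) ∂μ ≠ ⊤) : MemLp f 2 μ := by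
  obtain ⟨c, hc, hcM⟩ := exists_mul_sq_norm_le_quad hM
  have hi := (lintegral_ofReal_ne_top_iff_integrable
    ((measurable_quad M).comp hf).aestronglyMeasurable
    (Filter.Eventually.of_forall fun ω => quad_nonneg hM.posSemidef _)).1 h
  rw [memLp_two_iff_integrable_sq_norm hf.aestronglyMeasurable]
  refine (hi.const_mul c⁻¹).mono' (hf.norm.pow_const 2).aestronglyMeasurable
    (Filter.Eventually.of_forall fun ω => ?_)
  rw [Real.norm_of_nonneg (by positivity)]
  have := hcM (f ω)
  rw [inv_mul_eq_div, le_div_iff₀ hc]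
  simp only [Function.comp_apply]
  linarith

end Coercive

/-- Functions of finitely many members of a sequence of finite random variables are integrable. -/
theorem integrable_comp_prefix {Ω : Type*} [MeasurableSpace Ω] {μ : Measure Ω}
    [IsFiniteMeasure μ] {L : Type*} [Finite L] [Inhabited L] [MeasurableSpace L]
    [DiscreteMeasurableSpace L] {f : ℕ → Ω → L} (hf : ∀ t, Measurable (f t)) (K : ℕ)
    {Ψ : (ℕ → L) → ℝ} (hΨ : ∀ g h : ℕ → L, (∀ t < K, g t = h t) → Ψ g = Ψ h) :
    Integrable (fun ω => Ψ fun t => f t ω) μ := by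
  have : (fun ω => Ψ fun t => f t ω) =
      (fun h : Fin K → L => Ψ fun t => if ht : t < K then h ⟨t, ht⟩ else default) ∘
        fun ω t => f t ω := by
    funext ω
    exact hΨ _ _ fun t ht => by simp [ht]
  rw [this]
  refine Integrable.comp_measurable ?_ (measurable_pi_lambda _ fun t => hf t)
  have := Measure.isFiniteMeasure_map μ (fun ω (t : Fin K) => f t ω)
  exact Integrable.of_finite

/-! ### Decomposition of the local cost. -/

section Cost

variable {S : NCS} {Ω : Type*} [MeasurableSpace Ω] {μ : Measure Ω} {Z : S.Noise μ}

theorem selection_dotProduct (d : S.Link) (v : S.Link → ℝ) : S.selection d ⬝ᵥ v = v d := by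
  simp [selection]

/-- The cost of the estimation error of time `k` under deterministic grants. -/
def Noise.errCost (Z : S.Noise μ) (i : Fin S.N) (k : ℕ) (g : ℕ → S.Link) : ℝ :=
  ∫ ω, quad (S.inputWeight i k) (S.gain i k *ᵥ err i (Z.mean i) k g (Z.seed ω) k) ∂μ

/-- The local cost of the LQR law under deterministic grants. -/
def Noise.netCost (Z : S.Noise μ) (i : Fin S.N) (g : ℕ → S.Link) : ℝ :=
  ∫ ω, quad (S.riccati i 0) (Z.x₀ i ω) ∂μ + ∑ k ∈ Finset.range S.T,
    (Z.errCost i k g + ∫ ω, quad (S.riccati i (k + 1)) (Z.w i k ω) ∂μ + S.price (g k))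

theorem Noise.errCost_congr (Z : S.Noise μ) (i : Fin S.N) {k : ℕ} {g h : ℕ → S.Link}
    (hgh : ∀ t ≤ k, g t = h t) : Z.errCost i k g = Z.errCost i k h := by
  simp only [errCost, err_congr_grants i _ _ hgh]

theorem Noise.netCost_congr (Z : S.Noise μ) (i : Fin S.N) {g h : ℕ → S.Link}
    (hgh : ∀ t < S.T, g t = h t) : Z.netCost i g = Z.netCost i h := by
  unfold netCost
  congr 1
  refine Finset.sum_congr rfl fun k hk => ?_
  have hk := Finset.mem_range.1 hk
  rw [Z.errCost_congr i (fun t ht => hgh t (by omega)), hgh k hk]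

theorem Noise.netCost_nonneg (Z : S.Noise μ) (i : Fin S.N) (g : ℕ → S.Link) :
    0 ≤ Z.netCost i g := by
  refine add_nonneg (integral_nonneg fun ω => quad_nonneg (S.riccati_posSemidef i 0) _)
    (Finset.sum_nonneg fun k _ => add_nonneg (add_nonneg ?_ ?_) (S.price_nonneg _))
  · exact integral_nonneg fun ω => quad_nonneg (S.inputWeight_posDef i k).posSemidef _
  · exact integral_nonneg fun ω => quad_nonneg (S.riccati_posSemidef i (k + 1)) _

/-- The deviation of the input from certainty equivalence. -/
def ClosedLoop.deviation (e : S.ClosedLoop Z) (i : Fin S.N) (k : ℕ) (ω : Ω) : S.Input i :=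
  e.u i k ω + S.gain i k *ᵥ e.est i k ω

theorem ClosedLoop.memLp_x (e : S.ClosedLoop Z) (i : Fin S.N) {k : ℕ}
    (hu : ∀ t < k, MemLp (e.u i t) 2 μ) : MemLp (e.x i k) 2 μ := by
  induction k with
  | zero =>
    have : e.x i 0 = Z.x₀ i := funext fun ω => e.x_zero i ω
    rw [this]; exact Z.memLp_x₀ i
  | succ k ih =>
    have : e.x i (k + 1) = fun ω => S.A i *ᵥ e.x i k ω + S.B i *ᵥ e.u i k ω + Z.w i k ω :=
      funext fun ω => e.x_succ i k ω
    rw [this]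
    exact ((memLp_mulVec _ (ih fun t ht => hu t (by omega))).add
      (memLp_mulVec _ (hu k (by omega)))).add (Z.memLp_w i k)

/-- The integrand of the local cost of sub-system `i`. -/
def ClosedLoop.runCost (e : S.ClosedLoop Z) (i : Fin S.N) (ω : Ω) : ℝ :=
  quad (S.Q₂ i) (e.x i S.T ω) +
    ∑ k ∈ Finset.range S.T, (quad (S.Q₁ i) (e.x i k ω) + quad (S.R i) (e.u i k ω) +
      S.selection (e.ϑ i k ω) ⬝ᵥ S.price)

theorem ClosedLoop.stage_nonneg (e : S.ClosedLoop Z) (i : Fin S.N) (k : ℕ) (ω : Ω) :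
    0 ≤ quad (S.Q₁ i) (e.x i k ω) + quad (S.R i) (e.u i k ω) +
      S.selection (e.ϑ i k ω) ⬝ᵥ S.price := by
  rw [selection_dotProduct]
  exact add_nonneg (add_nonneg (quad_nonneg (S.Q₁_posSemidef i) _)
    (quad_nonneg (S.R_posDef i).posSemidef _)) (S.price_nonneg _)

theorem ClosedLoop.runCost_nonneg (e : S.ClosedLoop Z) (i : Fin S.N) (ω : Ω) :
    0 ≤ e.runCost i ω :=
  add_nonneg (quad_nonneg (S.Q₂_posSemidef i) _)
    (Finset.sum_nonneg fun k _ => e.stage_nonneg i k ω)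

/-- Finite cost forces square integrable inputs. -/
theorem ClosedLoop.memLp_u_of_loopCost_ne_top (e : S.ClosedLoop Z) (i : Fin S.N)
    (h : e.loopCost i (e.ϑ i) ≠ ⊤) {k : ℕ} (hk : k < S.T) : MemLp (e.u i k) 2 μ := by
  refine memLp_of_lintegral_quad_ne_top (S.R_posDef i) (e.measurable_u i k)
    (ne_top_of_le_ne_top h (lintegral_mono fun ω => ENNReal.ofReal_le_ofReal ?_))
  have h1 := Finset.single_le_sum (fun k _ => e.stage_nonneg i k ω) (Finset.mem_range.2 hk)
  have h2 := quad_nonneg (S.Q₂_posSemidef i) (e.x i S.T ω)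
  have h3 := quad_nonneg (S.Q₁_posSemidef i) (e.x i k ω)
  have h4 := S.price_nonneg (e.ϑ i k ω)
  simp only [selection_dotProduct] at h1 ⊢
  linarith

theorem ClosedLoop.deviationCost_nonneg (e : S.ClosedLoop Z) (i : Fin S.N) (k : ℕ) :
    0 ≤ ∫ ω, quad (S.inputWeight i k) (e.deviation i k ω) ∂μ :=
  integral_nonneg fun _ => quad_nonneg (S.inputWeight_posDef i k).posSemidef _

theorem ClosedLoop.integral_netCost_nonneg (e : S.ClosedLoop Z) (i : Fin S.N) :
    0 ≤ ∫ ω, Z.netCost i (fun t => e.ϑ i t ω) ∂μ :=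
  integral_nonneg fun _ => Z.netCost_nonneg i _

variable [IsProbabilityMeasure μ]

theorem ClosedLoop.memLp_est (e : S.ClosedLoop Z) (i : Fin S.N) {k : ℕ}
    (hx : MemLp (e.x i k) 2 μ) : MemLp (e.est i k) 2 μ := by
  have : e.est i k = e.x i k - e.estErr i k := by
    funext ω; rw [Pi.sub_apply, ← e.est_add_estErr]; simp
  rw [this]; exact hx.sub (e.memLp_estErr i k)

theorem ClosedLoop.integrable_netCost (e : S.ClosedLoop Z) (i : Fin S.N) :
    Integrable (fun ω => Z.netCost i fun t => e.ϑ i t ω) μ :=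
  integrable_comp_prefix (e.measurable_ϑ i) S.T fun _ _ => Z.netCost_congr i

theorem ClosedLoop.integrable_errCost (e : S.ClosedLoop Z) (i : Fin S.N) (k : ℕ) :
    Integrable (fun ω => Z.errCost i k fun t => e.ϑ i t ω) μ :=
  integrable_comp_prefix (e.measurable_ϑ i) (k + 1) fun _ _ h =>
    Z.errCost_congr i fun t ht => h t (by omega)

theorem ClosedLoop.integrable_price (e : S.ClosedLoop Z) (i : Fin S.N) (k : ℕ) :
    Integrable (fun ω => S.price (e.ϑ i k ω)) μ :=
  integrable_comp_prefix (Ψ := fun g => S.price (g k)) (e.measurable_ϑ i) (k + 1) fun g h hgh => by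
    rw [hgh k (by omega)]

theorem ClosedLoop.integral_netCost (e : S.ClosedLoop Z) (i : Fin S.N) :
    ∫ ω, Z.netCost i (fun t => e.ϑ i t ω) ∂μ =
      ∫ ω, quad (S.riccati i 0) (Z.x₀ i ω) ∂μ + ∑ k ∈ Finset.range S.T,
        (∫ ω, Z.errCost i k (fun t => e.ϑ i t ω) ∂μ +
          ∫ ω, quad (S.riccati i (k + 1)) (Z.w i k ω) ∂μ + ∫ ω, S.price (e.ϑ i k ω) ∂μ) := by
  simp only [Noise.netCost]
  have h1 (k : ℕ) := (e.integrable_errCost i k).add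
    (integrable_const (μ := μ) (∫ ω, quad (S.riccati i (k + 1)) (Z.w i k ω) ∂μ))
  have h2 (k : ℕ) := (h1 k).add (e.integrable_price i k)
  refine (integral_add (integrable_const _) (integrable_finsetSum _ fun k _ => h2 k)).trans ?_
  rw [integral_const, probReal_univ, one_smul]
  congr 1
  refine (integral_finsetSum _ fun k _ => h2 k).trans (Finset.sum_congr rfl fun k _ => ?_)
  refine (integral_add (h1 k) (e.integrable_price i k)).trans ?_
  congr 1
  refine (integral_add (e.integrable_errCost i k) (integrable_const _)).trans ?_
  rw [integral_const, probReal_univ, one_smul]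

/-- The mean cost of one stage. -/
theorem ClosedLoop.integral_stage (e : S.ClosedLoop Z) (i : Fin S.N) {k : ℕ}
    (hx : MemLp (e.x i k) 2 μ) (hu : MemLp (e.u i k) 2 μ) :
    Integrable (fun ω => quad (S.inputWeight i k) (e.u i k ω + S.gain i k *ᵥ e.x i k ω) +
      2 * ((S.A i *ᵥ e.x i k ω + S.B i *ᵥ e.u i k ω) ⬝ᵥ S.riccati i (k + 1) *ᵥ Z.w i k ω) +
      quad (S.riccati i (k + 1)) (Z.w i k ω)) μ ∧
    ∫ ω, (quad (S.inputWeight i k) (e.u i k ω + S.gain i k *ᵥ e.x i k ω) +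
      2 * ((S.A i *ᵥ e.x i k ω + S.B i *ᵥ e.u i k ω) ⬝ᵥ S.riccati i (k + 1) *ᵥ Z.w i k ω) +
      quad (S.riccati i (k + 1)) (Z.w i k ω)) ∂μ =
    ∫ ω, quad (S.inputWeight i k) (e.deviation i k ω) ∂μ +
      ∫ ω, Z.errCost i k (fun t => e.ϑ i t ω) ∂μ +
      ∫ ω, quad (S.riccati i (k + 1)) (Z.w i k ω) ∂μ := by
  have hest := e.memLp_est i hx
  have herr := e.memLp_estErr i k
  have hw := Z.memLp_w i k
  have hdev : MemLp (e.deviation i k) 2 μ := hu.add (memLp_mulVec _ hest)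
  have hLerr := memLp_mulVec (S.gain i k) herr
  have hMLerr := memLp_mulVec (S.inputWeight i k) hLerr
  have hnext : MemLp (fun ω => S.A i *ᵥ e.x i k ω + S.B i *ᵥ e.u i k ω) 2 μ :=
    (memLp_mulVec _ hx).add (memLp_mulVec _ hu)
  have hsq (ω : Ω) : quad (S.inputWeight i k) (e.u i k ω + S.gain i k *ᵥ e.x i k ω) =
      quad (S.inputWeight i k) (e.deviation i k ω) +
        2 * (e.deviation i k ω ⬝ᵥ S.inputWeight i k *ᵥ S.gain i k *ᵥ e.estErr i k ω) +
        quad (S.inputWeight i k) (S.gain i k *ᵥ e.estErr i k ω) := by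
    rw [← quad_add (isSymm_of_posSemidef (S.inputWeight_posDef i k).posSemidef), deviation,
      add_assoc, ← Matrix.mulVec_add, e.est_add_estErr]
  have i1 := integrable_quad (S.inputWeight i k) hdev
  have i2 := (integrable_dotProduct hdev hMLerr).const_mul 2
  have i3 := integrable_quad (S.inputWeight i k) hLerr
  have i4 := (integrable_dotProduct hnext (memLp_mulVec (S.riccati i (k + 1)) hw)).const_mul 2
  have i5 := integrable_quad (S.riccati i (k + 1)) hw
  -- The deviation is a function of the plant information, to which the error is orthogonal.
  have z2 : ∫ ω, e.deviation i k ω ⬝ᵥ S.inputWeight i k *ᵥ S.gain i k *ᵥ e.estErr i k ω ∂μ = 0 := by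
    refine integral_dotProduct_eq_zero hdev hMLerr fun j => ?_
    have hm : Measurable[e.plantSigma i k] (e.deviation i k) :=
      (e.measurable_u_plantSigma i k).add ((measurable_mulVec _).comp (e.measurable_est i k))
    exact e.integral_mul_clm_estErr i k
      ((ContinuousLinearMap.proj (R := ℝ) (φ := fun _ : Fin (S.m i) => ℝ) j).comp
        ((S.inputWeight i k).mulVecLin.toContinuousLinearMap.comp
          (S.gain i k).mulVecLin.toContinuousLinearMap))
      ((measurable_pi_apply j).comp hm).stronglyMeasurable (hdev.eval j)
  have z4 : ∫ ω, (S.A i *ᵥ e.x i k ω + S.B i *ᵥ e.u i k ω) ⬝ᵥ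
      S.riccati i (k + 1) *ᵥ Z.w i k ω ∂μ = 0 :=
    e.integral_dotProduct_w i k (f := fun z => S.A i *ᵥ z.1 + S.B i *ᵥ z.2)
      (((measurable_mulVec _).comp measurable_fst).add
        ((measurable_mulVec _).comp measurable_snd)) hnext _
  have e3 : ∫ ω, quad (S.inputWeight i k) (S.gain i k *ᵥ e.estErr i k ω) ∂μ =
      ∫ ω, Z.errCost i k (fun t => e.ϑ i t ω) ∂μ := by
    have := e.setIntegral_comp_estErr i k
      (φ := fun v => quad (S.inputWeight i k) (S.gain i k *ᵥ v))
      ((measurable_quad _).comp (measurable_mulVec _))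
      (fun g => integrable_quad _ (memLp_mulVec _ (Z.memLp_err i k g k))) MeasurableSet.univ
    simpa [Noise.errCost] using this
  simp only [hsq]
  refine ⟨(((i1.add i2).add i3).add i4).add i5, ?_⟩
  have s1 := integral_add (((i1.add i2).add i3).add i4) i5
  have s2 := integral_add ((i1.add i2).add i3) i4
  have s3 := integral_add (i1.add i2) i3
  have s4 := integral_add i1 i2
  rw [integral_const_mul, z2] at s4
  rw [integral_const_mul, z4] at s2
  simp only [Pi.add_apply] at s1 s2 s3 s4
  rw [s1, s2, s3, s4, e3]
  ring

/-- The local cost is the cost that is due to the grants plus a penalty for the deviation of the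
inputs from certainty equivalence. -/
theorem ClosedLoop.loopCost_eq (e : S.ClosedLoop Z) (i : Fin S.N)
    (hu : ∀ k < S.T, MemLp (e.u i k) 2 μ) :
    e.loopCost i (e.ϑ i) = ENNReal.ofReal (∫ ω, Z.netCost i (fun t => e.ϑ i t ω) ∂μ +
      ∑ k ∈ Finset.range S.T, ∫ ω, quad (S.inputWeight i k) (e.deviation i k ω) ∂μ) := by
  have hst (k : ℕ) (hk : k ∈ Finset.range S.T) := e.integral_stage i
    (e.memLp_x i fun t ht => hu t (ht.trans (Finset.mem_range.1 hk))) (hu k (Finset.mem_range.1 hk))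
  have hrun (ω : Ω) : e.runCost i ω = quad (S.riccati i 0) (Z.x₀ i ω) +
      ∑ k ∈ Finset.range S.T,
        (quad (S.inputWeight i k) (e.u i k ω + S.gain i k *ᵥ e.x i k ω) +
          2 * ((S.A i *ᵥ e.x i k ω + S.B i *ᵥ e.u i k ω) ⬝ᵥ S.riccati i (k + 1) *ᵥ Z.w i k ω) +
          quad (S.riccati i (k + 1)) (Z.w i k ω) + S.price (e.ϑ i k ω)) := by
    have h := S.quad_telescope i (fun k => e.x i k ω) (fun k => e.u i k ω) (fun k => Z.w i k ω)
      (fun k => e.x_succ i k ω)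
    rw [e.x_zero] at h
    rw [Finset.sum_add_distrib, ← add_assoc, ← h]
    simp only [runCost, selection_dotProduct]
    rw [Finset.sum_add_distrib, ← add_assoc]
  have i0 := integrable_quad (S.riccati i 0) (Z.memLp_x₀ i)
  have i1 (k : ℕ) (hk : k ∈ Finset.range S.T) := (hst k hk).1.add (e.integrable_price i k)
  have hint : Integrable (e.runCost i) μ := by
    rw [funext hrun]
    exact i0.add (integrable_finsetSum _ i1)
  have h1 : e.loopCost i (e.ϑ i) = ENNReal.ofReal (∫ ω, e.runCost i ω ∂μ) :=
    (ofReal_integral_eq_lintegral_ofReal hint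
      (Filter.Eventually.of_forall (e.runCost_nonneg i))).symm
  rw [h1, funext hrun, e.integral_netCost]
  congr 1
  refine (integral_add i0 (integrable_finsetSum _ i1)).trans ?_
  rw [add_assoc, ← Finset.sum_add_distrib]
  congr 1
  refine (integral_finsetSum _ i1).trans (Finset.sum_congr rfl fun k hk => ?_)
  refine (integral_add (hst k hk).1 (e.integrable_price i k)).trans ?_
  rw [(hst k hk).2]
  ring

/-- Certainty equivalence of the inputs of plant `i`. -/
def ClosedLoop.CertaintyEquivalentAt (e : S.ClosedLoop Z) (i : Fin S.N) : Prop :=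
  ∀ k < S.T, e.u i k =ᵐ[μ] fun ω => -(S.gain i k *ᵥ (μ[e.x i k | e.plantSigma i k]) ω)

theorem ClosedLoop.memLp_u_of_deviation (e : S.ClosedLoop Z) (i : Fin S.N)
    (h : ∀ k < S.T, e.deviation i k =ᵐ[μ] 0) {k : ℕ} (hk : k < S.T) : MemLp (e.u i k) 2 μ := by
  induction k using Nat.strong_induction_on with
  | _ k ih =>
    have hx := e.memLp_x i fun t ht => ih t ht (ht.trans hk)
    refine (memLp_mulVec (S.gain i k) (e.memLp_est i hx)).neg.ae_eq ?_
    filter_upwards [h k hk] with ω hω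
    exact (eq_neg_of_add_eq_zero_left hω).symm

/-- The conditional mean is the estimate once the state is square integrable (`condExp` is zero by
default on nonintegrable functions). Neither side assumes finite cost, so integrability is carried
along in time: square integrable past inputs give such a state, estimate and next input. -/
theorem ClosedLoop.certaintyEquivalentAt_iff (e : S.ClosedLoop Z) (i : Fin S.N) :
    e.CertaintyEquivalentAt i ↔ ∀ k < S.T, e.deviation i k =ᵐ[μ] 0 := by
  have key (k : ℕ) (hx : MemLp (e.x i k) 2 μ) :
      (e.u i k =ᵐ[μ] fun ω => -(S.gain i k *ᵥ (μ[e.x i k | e.plantSigma i k]) ω)) ↔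
        e.deviation i k =ᵐ[μ] 0 := by
    refine Filter.eventually_congr ?_
    filter_upwards [e.condExp_x i k hx] with ω hω
    rw [hω, Pi.zero_apply, deviation, eq_neg_iff_add_eq_zero]
  refine ⟨fun h k => ?_, fun h k hk =>
    (key k (e.memLp_x i fun t ht => e.memLp_u_of_deviation i h (ht.trans hk))).2 (h k hk)⟩
  suffices k < S.T → MemLp (e.u i k) 2 μ ∧ e.deviation i k =ᵐ[μ] 0 from fun hk => (this hk).2
  induction k using Nat.strong_induction_on with
  | _ k ih =>
    intro hk
    have hx := e.memLp_x i fun t ht => (ih t ht (ht.trans hk)).1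
    have hd := (key k hx).1 (h k hk)
    refine ⟨(memLp_mulVec (S.gain i k) (e.memLp_est i hx)).neg.ae_eq ?_, hd⟩
    filter_upwards [hd] with ω hω
    exact (eq_neg_of_add_eq_zero_left hω).symm

theorem ClosedLoop.ofReal_netCost_le_loopCost (e : S.ClosedLoop Z) (i : Fin S.N) :
    ENNReal.ofReal (∫ ω, Z.netCost i (fun t => e.ϑ i t ω) ∂μ) ≤ e.loopCost i (e.ϑ i) := by
  by_cases h : e.loopCost i (e.ϑ i) = ⊤
  · rw [h]; exact le_top
  · rw [e.loopCost_eq i fun k => e.memLp_u_of_loopCost_ne_top i h]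
    exact ENNReal.ofReal_le_ofReal
      (le_add_of_nonneg_right (Finset.sum_nonneg fun k _ => e.deviationCost_nonneg i k))

theorem ClosedLoop.CertaintyEquivalentAt.loopCost_eq {e : S.ClosedLoop Z} {i : Fin S.N}
    (h : e.CertaintyEquivalentAt i) :
    e.loopCost i (e.ϑ i) = ENNReal.ofReal (∫ ω, Z.netCost i (fun t => e.ϑ i t ω) ∂μ) := by
  rw [e.certaintyEquivalentAt_iff] at h
  rw [e.loopCost_eq i fun k => e.memLp_u_of_deviation i h, Finset.sum_eq_zero, add_zero]
  intro k hk
  rw [integral_eq_zero_of_ae]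
  filter_upwards [h k (Finset.mem_range.1 hk)] with ω hω
  simp [hω, quad]

/-- The bound makes the cost finite, so the decomposition applies and every penalty is zero;
positive definiteness of the weights then kills the deviations almost surely. -/
theorem ClosedLoop.certaintyEquivalentAt_of_loopCost_le (e : S.ClosedLoop Z) (i : Fin S.N)
    (h : e.loopCost i (e.ϑ i) ≤ ENNReal.ofReal (∫ ω, Z.netCost i (fun t => e.ϑ i t ω) ∂μ)) :
    e.CertaintyEquivalentAt i := by
  have hu (k : ℕ) (hk : k < S.T) : MemLp (e.u i k) 2 μ :=
    e.memLp_u_of_loopCost_ne_top i (ne_top_of_le_ne_top ENNReal.ofReal_ne_top h) hk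
  rw [e.loopCost_eq i hu, ENNReal.ofReal_le_ofReal_iff (e.integral_netCost_nonneg i)] at h
  rw [e.certaintyEquivalentAt_iff]
  intro k hk
  have h0 : ∫ ω, quad (S.inputWeight i k) (e.deviation i k ω) ∂μ = 0 := by
    refine le_antisymm ?_ (e.deviationCost_nonneg i k)
    have := Finset.single_le_sum (fun k _ => e.deviationCost_nonneg i k) (Finset.mem_range.2 hk)
    linarith
  have hx := e.memLp_x i fun t ht => hu t (ht.trans hk)
  have hdev : MemLp (e.deviation i k) 2 μ :=
    (hu k hk).add (memLp_mulVec (S.gain i k) (e.memLp_est i hx))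
  rw [integral_eq_zero_iff_of_nonneg
    (fun _ => quad_nonneg (S.inputWeight_posDef i k).posSemidef _) (integrable_quad _ hdev)] at h0
  filter_upwards [h0] with ω hω
  by_contra hne
  exact (quad_pos (S.inputWeight_posDef i k) hne).ne' hω

end Cost

/-! ### Social cost, minimizers and deterministic grants. -/

section SocialCost

theorem sum_coe_sub_coe {ι : Type*} (s : Finset ι) (a b : ι → ℝ≥0∞) (hb : ∀ i, b i ≠ ⊤) :
    ∑ i ∈ s, ((a i : EReal) - (b i : EReal)) =
      ((∑ i ∈ s, a i : ℝ≥0∞) : EReal) + ((-∑ i ∈ s, (b i).toReal : ℝ) : EReal) := by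
  classical
  induction s using Finset.induction_on with
  | empty => simp
  | insert i s hi ih =>
    have h : (b i : EReal) = (((b i).toReal : ℝ) : EReal) :=
      by
      rw [← EReal.toReal_coe_ennreal, EReal.coe_toReal (by simpa using hb i) (by simp)]
    rw [Finset.sum_insert hi, Finset.sum_insert hi, Finset.sum_insert hi, ih, h,
      EReal.coe_ennreal_add, neg_add, EReal.coe_add, EReal.coe_neg, sub_eq_add_neg]
    exact add_add_add_comm _ _ _ _

theorem exists_isMin_comp_prefix {L : Type*} [Finite L] [Inhabited L] (K : ℕ)
    {Ψ : (ℕ → L) → ℝ} (hΨ : ∀ g h : ℕ → L, (∀ t < K, g t = h t) → Ψ g = Ψ h)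
    {C : Set (ℕ → L)} (hC : C.Nonempty) : ∃ g ∈ C, ∀ h ∈ C, Ψ g ≤ Ψ h := by
  have hfin : (Ψ '' C).Finite := by
    refine (Set.finite_range fun h : Fin K → L =>
      Ψ fun t => if ht : t < K then h ⟨t, ht⟩ else default).subset ?_
    rintro _ ⟨g, -, rfl⟩
    exact ⟨fun t => g t, hΨ _ _ fun t ht => by simp [ht]⟩
  obtain ⟨_, ⟨g, hg, rfl⟩, hmin⟩ := Set.exists_min_image _ id hfin (hC.image Ψ)
  exact ⟨g, hg, fun h hh => hmin _ ⟨h, hh, rfl⟩⟩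

/-- Some assignment of links respects the capacities. -/
theorem exists_assignment (S : NCS) :
    ∃ a : Fin S.N → S.Link, ∀ d, ∑ j, S.selection (a j) d ≤ (S.cap d : ℝ) := by
  classical
  -- View link `d` as `cap d` slots: the total capacity allows an injection of the sub-systems into
  -- the slots, and each takes the link of its slot.
  have hcard : Fintype.card (Fin S.N) ≤ Fintype.card (Σ d : S.Link, Fin (S.cap d)) := by
    simpa using S.le_sum_cap
  obtain ⟨φ⟩ := Function.Embedding.nonempty_of_card_le hcard
  refine ⟨fun j => (φ j).1, fun d => ?_⟩
  have h1 : ∑ j, S.selection (φ j).1 d = ((Finset.univ.filter fun j => (φ j).1 = d).card : ℝ) := by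
    rw [Finset.card_filter, Nat.cast_sum]
    refine Finset.sum_congr rfl fun j _ => ?_
    by_cases h : (φ j).1 = d
    · simp [selection, h]
    · simp [selection, h, Ne.symm h]
  rw [h1, Nat.cast_le]
  have h2 := Finset.card_le_card_of_injOn (s := Finset.univ.filter fun j => (φ j).1 = d)
    (t := Finset.univ.map (Function.Embedding.sigmaMk (β := fun d : S.Link => Fin (S.cap d)) d)) φ
    (fun j hj => by
      obtain rfl : (φ j).1 = d := by simpa using hj
      simp) φ.injective.injOn
  simpa using h2

variable {S : NCS} {Ω : Type*} [MeasurableSpace Ω] {μ : Measure Ω} {Z : S.Noise μ}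

theorem N_pos (S : NCS) : 0 < S.N := (Nat.zero_le _).trans_lt (S.cap_lt 0)

/-- The total cost of all sub-systems. -/
def ClosedLoop.totalCost (e : S.ClosedLoop Z) : ℝ≥0∞ := ∑ i, e.loopCost i (e.ϑ i)

/-- Finite local minima contribute the same real constant to both sides, and it cancels even when a
total cost is infinite. -/
theorem ClosedLoop.socialCost_le_iff (e f : S.ClosedLoop Z) (V : Set Signal)
    (hfin : ∀ i, localMin Z V i ≠ ⊤) :
    e.socialCost V ≤ f.socialCost V ↔ e.totalCost ≤ f.totalCost := by
  have hN : (0 : EReal) < ((S.N : ℝ) : EReal) := by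
    exact_mod_cast S.N_pos
  have h (z : EReal) : (((S.N : ℝ)⁻¹ : ℝ) : EReal) * z = z / ((S.N : ℝ) : EReal) := by
    rw [EReal.div_eq_inv_mul, EReal.coe_inv]
  unfold socialCost
  rw [h, h, (EReal.strictMono_div_right_of_pos hN (EReal.coe_ne_top _)).le_iff_le,
    sum_coe_sub_coe _ _ _ hfin, sum_coe_sub_coe _ _ _ hfin,
    (EReal.addLECancellable_coe _).add_le_add_iff_right, EReal.coe_ennreal_le_coe_ennreal_iff]
  rfl

/-- The LQR law applied to the estimate, with the network policies of `p`. -/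
def Policies.withLQR (p : S.Policies) (Z : S.Noise μ) : S.Policies where
  γ i k I := -(S.gain i k *ᵥ estimate i (Z.mean i) I k)
  ξ := p.ξ
  π := p.π
  measurable_γ i k := ((measurable_mulVec _).comp (measurable_estimate i (Z.mean i) k k)).neg
  measurable_ξ := p.measurable_ξ
  measurable_π := p.measurable_π

/-- Open-loop requests, all of which are granted. -/
def openLoop (r : Fin S.N → ℕ → S.Link) : S.Policies where
  γ _ _ _ := 0
  ξ i k _ := r i k
  π k I := I.1 (Fin.last k)
  measurable_γ _ _ := measurable_const
  measurable_ξ _ _ := measurable_const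
  measurable_π _ := by fun_prop

theorem θ_openLoop (r : Fin S.N → ℕ → S.Link) (i : Fin S.N) (k : ℕ) (ω : Ω) :
    (((openLoop r).withLQR Z).closedLoop Z).θ i k ω = r i k :=
  (((openLoop r).withLQR Z).closedLoop Z).θ_eq i k ω

theorem ϑ_openLoop (r : Fin S.N → ℕ → S.Link) (i : Fin S.N) (k : ℕ) (ω : Ω) :
    (((openLoop r).withLQR Z).closedLoop Z).ϑ i k ω = r i k :=
  (congrFun ((((openLoop r).withLQR Z).closedLoop Z).ϑ_eq k ω) i).trans (θ_openLoop r i k ω)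

/-- Network policies that ignore the inputs generate the same grants under all plant laws. -/
theorem ClosedLoop.ϑ_eq_of_usesOnly (e f : S.ClosedLoop Z)
    (h : S.UsesOnly {Signal.request, Signal.grant} e.ξ) (hξ : f.ξ = e.ξ) (hπ : f.π = e.π) :
    ∀ k ω, (∀ i, e.θ i k ω = f.θ i k ω) ∧ ∀ i, e.ϑ i k ω = f.ϑ i k ω := by
  intro k
  induction k using Nat.strong_induction_on with
  | _ k ih =>
    intro ω
    have hθ (i : Fin S.N) : e.θ i k ω = f.θ i k ω := by
      rw [e.θ_eq, f.θ_eq, hξ]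
      exact h i k _ _ (fun _ => funext fun t => (ih t t.2 ω).1 i)
        (fun _ => funext fun t => (ih t t.2 ω).2 i) (by simp)
    refine ⟨hθ, fun i => congrFun ((e.ϑ_eq k ω).trans (Eq.trans ?_ (f.ϑ_eq k ω).symm)) i⟩
    rw [hπ]
    refine congrArg _ (Prod.ext (funext fun t => funext fun j => ?_)
      (funext fun t => funext fun j => (ih t t.2 ω).2 j))
    -- The manager also sees the requests of the present time, which is why `hθ` is established
    -- before the grants are compared.
    rcases Nat.lt_succ_iff_lt_or_eq.1 t.2 with ht | ht
    · exact (ih t ht ω).1 j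
    · simpa only [ht] using hθ j

/-- The total cost of the LQR law under the grants of `e`. -/
def ClosedLoop.totalNetCost (e : S.ClosedLoop Z) : ℝ≥0∞ :=
  ∑ i, ENNReal.ofReal (∫ ω, Z.netCost i (fun t => e.ϑ i t ω) ∂μ)

theorem ClosedLoop.totalNetCost_congr {e f : S.ClosedLoop Z}
    (h : ∀ i, ∀ k < S.T, e.ϑ i k =ᵐ[μ] f.ϑ i k) : e.totalNetCost = f.totalNetCost := by
  refine Finset.sum_congr rfl fun i _ => congrArg _ (integral_congr_ae ?_)
  have : ∀ᵐ ω ∂μ, ∀ k < S.T, e.ϑ i k ω = f.ϑ i k ω := by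
    refine ae_all_iff.2 fun k => ?_
    by_cases hk : k < S.T
    · filter_upwards [h i k hk] with ω hω _ using hω
    · exact Filter.Eventually.of_forall fun ω hk' => absurd hk' hk
  filter_upwards [this] with ω hω using Z.netCost_congr i hω

variable [IsProbabilityMeasure μ]

theorem Policies.certaintyEquivalent_withLQR (p : S.Policies) :
    ((p.withLQR Z).closedLoop Z).CertaintyEquivalent := by
  refine fun i => (((p.withLQR Z).closedLoop Z).certaintyEquivalentAt_iff i).2 fun k _ =>
    Filter.Eventually.of_forall fun ω => ?_
  rw [ClosedLoop.deviation, ((p.withLQR Z).closedLoop Z).u_eq]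
  exact neg_add_cancel _

theorem ClosedLoop.totalNetCost_le (e : S.ClosedLoop Z) : e.totalNetCost ≤ e.totalCost :=
  Finset.sum_le_sum fun i _ => e.ofReal_netCost_le_loopCost i

theorem ClosedLoop.CertaintyEquivalent.totalCost_eq {e : S.ClosedLoop Z}
    (h : e.CertaintyEquivalent) : e.totalCost = e.totalNetCost :=
  Finset.sum_congr rfl fun i _ => ClosedLoop.CertaintyEquivalentAt.loopCost_eq (h i)

/-- Each local cost is at least its share of `totalNetCost`. One strict excess would make the sum
strictly larger, as the remaining shares are finite. -/
theorem ClosedLoop.certaintyEquivalent_of_totalCost_le (e : S.ClosedLoop Z)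
    (h : e.totalCost ≤ e.totalNetCost) : e.CertaintyEquivalent := by
  intro i
  refine e.certaintyEquivalentAt_of_loopCost_le i (le_of_not_gt fun hlt => ?_)
  refine h.not_gt ?_
  rw [totalCost, totalNetCost, ← Finset.add_sum_erase _ _ (Finset.mem_univ i),
    ← Finset.add_sum_erase _ _ (Finset.mem_univ i)]
  refine ENNReal.add_lt_add_of_lt_of_le ?_ hlt
    (Finset.sum_le_sum fun j _ => e.ofReal_netCost_le_loopCost j)
  exact ENNReal.sum_ne_top.2 fun j _ => ENNReal.ofReal_ne_top

theorem ClosedLoop.totalNetCost_eq (e : S.ClosedLoop Z) :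
    e.totalNetCost = ENNReal.ofReal (∫ ω, ∑ i, Z.netCost i (fun t => e.ϑ i t ω) ∂μ) := by
  rw [integral_finsetSum _ fun i _ => e.integrable_netCost i,
    ENNReal.ofReal_sum_of_nonneg fun i _ => e.integral_netCost_nonneg i]
  rfl

/-- The local minimum is finite and attained by open-loop requests. -/
theorem localMin_attained (Z : S.Noise μ) (V : Set Signal) (i : Fin S.N) :
    localMin Z V i ≠ ⊤ ∧ ∃ e : S.ClosedLoop Z, S.UsesOnly V e.ξ ∧ e.GrantsAll ∧
      e.loopCost i (e.θ i) = localMin Z V i := by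
  obtain ⟨g, -, hg⟩ := exists_isMin_comp_prefix S.T (Ψ := Z.netCost i)
    (fun _ _ => Z.netCost_congr i) Set.univ_nonempty
  have hθ (f : S.ClosedLoop Z) (hf : f.GrantsAll) : f.loopCost i (f.θ i) = f.loopCost i (f.ϑ i) := by
    rw [show f.θ i = f.ϑ i from funext fun k => funext fun ω => (hf i k ω).symm]
  obtain ⟨e, hV, hall, hcost⟩ : ∃ e : S.ClosedLoop Z, S.UsesOnly V e.ξ ∧ e.GrantsAll ∧
      e.loopCost i (e.θ i) = ENNReal.ofReal (Z.netCost i g) := by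
    -- All sub-systems may request the same `g`, because `GrantsAll` involves no capacities and only
    -- the cost of `i` counts.
    have hall : (((openLoop fun _ => g).withLQR Z).closedLoop Z).GrantsAll := fun j k ω =>
      (ϑ_openLoop (fun _ => g) j k ω).trans (θ_openLoop (fun _ => g) j k ω).symm
    refine ⟨_, fun _ _ _ _ _ _ _ => rfl, hall, ?_⟩
    rw [hθ _ hall, ClosedLoop.CertaintyEquivalentAt.loopCost_eq
      ((openLoop fun _ => g).certaintyEquivalent_withLQR i)]
    simp only [ϑ_openLoop, integral_const, probReal_univ, one_smul]
  have hmin : localMin Z V i = ENNReal.ofReal (Z.netCost i g) := by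
    refine le_antisymm (hcost ▸ iInf_le
      (fun e : {e : S.ClosedLoop Z // S.UsesOnly V e.ξ ∧ e.GrantsAll} => e.1.loopCost i (e.1.θ i))
      ⟨e, hV, hall⟩) (le_iInf fun f => ?_)
    rw [hθ f.1 f.2.2]
    refine le_trans (ENNReal.ofReal_le_ofReal ?_) (f.1.ofReal_netCost_le_loopCost i)
    have := integral_mono (integrable_const (μ := μ) (Z.netCost i g)) (f.1.integrable_netCost i)
      fun ω => hg (fun t => f.1.ϑ i t ω) (Set.mem_univ _)
    rwa [integral_const, probReal_univ, one_smul] at this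
  exact ⟨by rw [hmin]; exact ENNReal.ofReal_ne_top, e, hV, hall, hcost.trans hmin.symm⟩

/-- Some feasible certainty equivalent closed loop costs no more than the LQR law under the grants
of any feasible closed loop. -/
theorem exists_totalCost_le (Z : S.Noise μ) (V : Set Signal) :
    ∃ e : S.ClosedLoop Z, e.Feasible V ∧ e.CertaintyEquivalent ∧
      ∀ f : S.ClosedLoop Z, f.Feasible V → e.totalCost ≤ f.totalNetCost := by
  obtain ⟨a, ha⟩ := S.exists_assignment
  -- Only the capacities constrain `g`. Dropping the tolerances is a relaxation for the competitors,
  -- and it loses nothing because the minimizer is requested exactly as granted.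
  obtain ⟨g, hgC, hg⟩ := exists_isMin_comp_prefix S.T
    (Ψ := fun g : ℕ → Fin S.N → S.Link => ∑ i, Z.netCost i fun t => g t i)
    (fun g h hgh => Finset.sum_congr rfl fun i _ => Z.netCost_congr i fun t ht => by rw [hgh t ht])
    (C := {g | ∀ t < S.T, ∀ d, ∑ j, S.selection (g t j) d ≤ (S.cap d : ℝ)})
    ⟨fun _ => a, fun _ _ => ha⟩
  have hce := (openLoop fun i k => g k i).certaintyEquivalent_withLQR (Z := Z)
  refine ⟨((openLoop fun i k => g k i).withLQR Z).closedLoop Z,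
    ⟨fun _ _ _ _ _ _ _ => rfl, Filter.Eventually.of_forall fun ω k hk => ⟨fun i => ?_, ?_⟩⟩, hce,
    fun f hf => ?_⟩
  · simp [ϑ_openLoop, θ_openLoop]
  · simpa only [ϑ_openLoop] using hgC k hk
  · rw [hce.totalCost_eq, ClosedLoop.totalNetCost_eq, ClosedLoop.totalNetCost_eq]
    refine ENNReal.ofReal_le_ofReal (integral_mono_ae ?_
      (integrable_finsetSum _ fun i _ => f.integrable_netCost i) ?_)
    · simp only [ϑ_openLoop]
      exact integrable_const _
    · filter_upwards [hf.2] with ω hω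
      simp only [ϑ_openLoop]
      exact hg (fun t i => f.ϑ i t ω) fun t ht d => (hω t ht).2 d

end SocialCost

end NCS

end

theorem theorem1 (S : NCS) {Ω : Type*} [MeasurableSpace Ω] (μ : Measure Ω)
    [IsProbabilityMeasure μ] (Z : S.Noise μ) (V : Set NCS.Signal) :
    -- the local minima in the social cost are finite and attained
    (∀ i, NCS.localMin Z V i ≠ ⊤ ∧ ∃ e : S.ClosedLoop Z,
      S.UsesOnly V e.ξ ∧ e.GrantsAll ∧ e.loopCost i (e.θ i) = NCS.localMin Z V i) ∧
    -- the social problem has an optimal triple of policies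
    (∃ e : S.ClosedLoop Z, e.IsOptimal V) ∧
    -- every optimal plant control law is of certainty equivalence form
    (∀ e : S.ClosedLoop Z, e.IsOptimal V → e.CertaintyEquivalent) ∧
    -- the certainty equivalence law exists for all delay control and allocation policies
    (∀ p : S.Policies, ∃ e : S.ClosedLoop Z,
      e.ξ = p.ξ ∧ e.π = p.π ∧ e.CertaintyEquivalent) ∧
    -- separation: with this law fixed, the network policies remain to be optimized
    (∀ e : S.ClosedLoop Z, e.IsOptimal V ↔
      e.Feasible V ∧ e.CertaintyEquivalent ∧ ∀ f : S.ClosedLoop Z,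
        f.Feasible V → f.CertaintyEquivalent → e.socialCost V ≤ f.socialCost V) ∧
    -- separation: the law is the unique best one for every realized link assignment
    (∀ e f : S.ClosedLoop Z, (∀ i, ∀ k < S.T, e.ϑ i k =ᵐ[μ] f.ϑ i k) →
      e.CertaintyEquivalent → e.socialCost V ≤ f.socialCost V ∧
        (f.socialCost V ≤ e.socialCost V → f.CertaintyEquivalent)) ∧
    -- separation: it is the unique best response to network policies that ignore the inputs
    (∀ e : S.ClosedLoop Z, S.UsesOnly {NCS.Signal.request, NCS.Signal.grant} e.ξ →
      (e.CertaintyEquivalent ↔ ∀ f : S.ClosedLoop Z, f.ξ = e.ξ → f.π = e.π →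
        e.socialCost V ≤ f.socialCost V)) := by
  have hloc := NCS.localMin_attained Z V
  have hle (e f : S.ClosedLoop Z) := e.socialCost_le_iff f V fun i => (hloc i).1
  obtain ⟨o, hoF, hoCE, ho⟩ := NCS.exists_totalCost_le Z V
  have hopt : o.IsOptimal V :=
    ⟨hoF, fun f hf => (hle o f).2 ((ho f hf).trans f.totalNetCost_le)⟩
  -- An optimal `e` costs no more than `o`, which costs no more than the LQR law under the grants of
  -- `e`; so `e` pays no penalty.
  have hCE (e : S.ClosedLoop Z) (he : e.IsOptimal V) : e.CertaintyEquivalent :=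
    e.certaintyEquivalent_of_totalCost_le (((hle e o).1 (he.2 o hoF)).trans (ho e he.1))
  have hsame (e f : S.ClosedLoop Z) (h : ∀ i, ∀ k < S.T, e.ϑ i k =ᵐ[μ] f.ϑ i k)
      (he : e.CertaintyEquivalent) : e.socialCost V ≤ f.socialCost V ∧
        (f.socialCost V ≤ e.socialCost V → f.CertaintyEquivalent) := by
    have heq : e.totalCost = f.totalNetCost :=
      he.totalCost_eq.trans (NCS.ClosedLoop.totalNetCost_congr h)
    exact ⟨(hle e f).2 (heq.trans_le f.totalNetCost_le),
      fun hfe => f.certaintyEquivalent_of_totalCost_le (((hle f e).1 hfe).trans heq.le)⟩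
  have hex (p : S.Policies) : ∃ e : S.ClosedLoop Z,
      e.ξ = p.ξ ∧ e.π = p.π ∧ e.CertaintyEquivalent :=
    ⟨(p.withLQR Z).closedLoop Z, rfl, rfl, p.certaintyEquivalent_withLQR⟩
  refine ⟨hloc, ⟨o, hopt⟩, hCE, hex, fun e => ⟨fun he => ⟨he.1, hCE e he, fun f hf _ => he.2 f hf⟩,
    fun he => ⟨he.1, fun f hf => (he.2.2 o hoF hoCE).trans (hopt.2 f hf)⟩⟩, hsame,
    fun e he => ⟨fun hce f hξ hπ => (hsame e f (fun i k _ => ?_) hce).1, fun hmin => ?_⟩⟩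
  · exact Filter.Eventually.of_forall fun ω => (e.ϑ_eq_of_usesOnly f he hξ hπ k ω).2 i
  -- The LQR law under the same network policies sees the same grants, so a minimizing `e` ties with
  -- it and the equality case applies.
  · obtain ⟨f, hξ, hπ, hf⟩ := hex e.toPolicies
    refine (hsame f e (fun i k _ => ?_) hf).2 (hmin f hξ hπ)
    exact Filter.Eventually.of_forall fun ω => ((e.ϑ_eq_of_usesOnly f he hξ hπ k ω).2 i).symm
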